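/- Let $S$ be the monoid with the presentation $$S=\langle a,b,x_n,y_n\ (n\in\mathbb Z)\ :\ abx_n=bx_n,\ aby_n=by_{n+1}\ (n\in\mathbb Z)\rangle .$$ Then $S$ is left cancellative, $S$ is strongly C$^*$-regular, $S$ is not finitely aligned, the canonical quotient map $\mathcal G_P(S)\to\mathcal G(S)$ is an isomorphism of topological groupoids (in short, $\mathcal G_P(S)=\mathcal G(S)$), and this groupoid is not Hausdorff. Here, for a left cancellative monoid $S$, the following definitions are used. The left inverse hull $I_\ell(S)$ is the inverse semigroup of partial bijections of $S$ generated by the left translations $t\mapsto st$. Its semigroup of idempotents is denoted by $E(S)$. The constructible ideals are the right ideals $s_1^{-1}t_1\cdots s_n^{-1}t_nS$, and $\mathcal J(S)$ is the set of all of them. For $X\in\mathcal J(S)$, the identity map of $X$ is denoted by $p_X$; thus $E(S)=\{p_X: X\in\mathcal J(S)\}$. The monoid $S$ is finitely aligned if the right ideal $sS\cap tS$ is finitely generated (possibly empty) for all $s,t\in S$. It is strongly C$^*$-regular if, whenever $h_1,\dots,h_n\in I_\ell(S)$ and $X,X_1,\dots,X_m\in\mathcal J(S)$ satisfy $$\emptyset\ne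 X\setminus\bigcup_{i=1}^m X_i\subset\bigcup_{k=1}^n\{s\in S: h_ks=s\},$$ there are $Y_1,\dots,Y_l\in\mathcal J(S)$ and indices $k_1,\dots,k_l\in\{1,\dots,n\}$ such that $X\setminus\bigcup_i X_i\subset\bigcup_j Y_j$ and $h_{k_j}p_{Y_j}=p_{Y_j}$ for all $j$. Let $\widehat{E(S)}$ be the space of nonzero semigroup homomorphisms $\chi\colon E(S)\to\{0,1\}$ with the topology of pointwise convergence. For $s\in S$ let $\chi_s(p_X)=1$ if $s\in X$ and $\chi_s(p_X)=0$ otherwise, and let $\Omega(S)$ be the closure of $\{\chi_s:s\in S\}$ in $\widehat{E(S)}$. The groupoid $\mathcal G(I_\ell(S))$ consists of the classes $[g,\chi]$ of pairs $(g,\chi)\in I_\ell(S)\times\widehat{E(S)}$ with $\chi(g^{-1}g)=1$, where $[g,\chi]=[h,\psi]$ if and only if $\chi=\psi$ and $gp=hp$ for some $p\in E(S)$ with $\chi(p)=1$. The source of $[g,\chi]$ is $\chi$, its range is $\chi(g^{-1}\cdot g)$, the product is $[g,\chi][h,\psi]=[gh,\psi]$ if $\chi=\psi(h^{-1}\cdot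 h)$, and the inverse is $[g,\chi]^{-1}=[g^{-1},\chi(g^{-1}\cdot g)]$. A basis of the topology is given by the sets $\{[g,\chi]:\chi\in U\}$, where $g\in I_\ell(S)$ and $U$ is an open subset of $\{\chi:\chi(g^{-1}g)=1\}$. The groupoid $\mathcal G_P(S)$ is the restriction of $\mathcal G(I_\ell(S))$ to the closed invariant set $\Omega(S)$. The groupoid $\mathcal G(S)$ is the quotient topological groupoid $\mathcal G_P(S)/{\sim}$, where $[g,\chi]\sim[h,\chi]$ if and only if there are $X,X_1,\dots,X_m\in\mathcal J(S)$, $m\ge 0$, such that $\chi(p_X)=1$, $\chi(p_{X_i})=0$ for all $i$, and $g$ and $h$ coincide on $X\setminus\bigcup_i X_i$. -/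

import Mathlib

/-! ### Groupoids given by a set of arrows over a set of units -/

/-- A groupoid with set of units `X` and set of arrows `A`; the product `mul α β _` is defined
when the source of `α` is the range of `β`. -/
structure ArrowGroupoid (X A : Type*) where
  source : A → X
  range : A → X
  unit : X → A
  inv : A → A
  mul : (α β : A) → source α = range β → A
  source_unit : ∀ x, source (unit x) = x
  range_unit : ∀ x, range (unit x) = x
  source_inv : ∀ α, source (inv α) = range α
  range_inv : ∀ α, range (inv α) = source α
  source_mul : ∀ α β h, source (mul α β h) = source β
  range_mul : ∀ α β h, range (mul α β h) = range α
  unit_mul : ∀ α, mul (unit (range α)) α (source_unit _) = α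
  mul_unit : ∀ α, mul α (unit (source α)) (range_unit _).symm = α
  mul_assoc : ∀ α β γ (h : source α = range β) (k : source β = range γ),
    mul (mul α β h) γ ((source_mul α β h).trans k) =
      mul α (mul β γ k) (h.trans (range_mul β γ k).symm)
  inv_mul : ∀ α, mul (inv α) α (source_inv α) = unit (source α)
  mul_inv : ∀ α, mul α (inv α) (range_inv α).symm = unit (range α)

namespace ArrowGroupoid

variable {X A : Type*}

/-- The restriction of a groupoid to an invariant set of units. -/
def restrict (G : ArrowGroupoid X A) (Z : Set X)
    (hZ : ∀ α, G.source α ∈ Z → G.range α ∈ Z) :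
    ArrowGroupoid Z {α : A // G.source α ∈ Z} where
  source α := ⟨G.source α.1, α.2⟩
  range α := ⟨G.range α.1, hZ _ α.2⟩
  unit x := ⟨G.unit x.1, by rw [G.source_unit]; exact x.2⟩
  inv α := ⟨G.inv α.1, by rw [G.source_inv]; exact hZ _ α.2⟩
  mul α β h := ⟨G.mul α.1 β.1 (congrArg Subtype.val h), by rw [G.source_mul]; exact β.2⟩
  source_unit x := Subtype.ext (G.source_unit _)
  range_unit x := Subtype.ext (G.range_unit _)
  source_inv α := Subtype.ext (G.source_inv _)
  range_inv α := Subtype.ext (G.range_inv _)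
  source_mul α β h := Subtype.ext (G.source_mul _ _ _)
  range_mul α β h := Subtype.ext (G.range_mul _ _ _)
  unit_mul α := Subtype.ext (G.unit_mul _)
  mul_unit α := Subtype.ext (G.mul_unit _)
  mul_assoc α β γ h k := Subtype.ext (G.mul_assoc _ _ _ _ _)
  inv_mul α := Subtype.ext (G.inv_mul _)
  mul_inv α := Subtype.ext (G.mul_inv _)

/-- A congruence on a groupoid that is trivial on units. -/
structure IsCongruence (G : ArrowGroupoid X A) (r : Setoid A) : Prop where
  source_eq : ∀ {α β}, r α β → G.source α = G.source β
  range_eq : ∀ {α β}, r α β → G.range α = G.range β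
  mul : ∀ {α α' β β'} (h : G.source α = G.range β) (h' : G.source α' = G.range β'),
    r α α' → r β β' → r (G.mul α β h) (G.mul α' β' h')

theorem mul_congr (G : ArrowGroupoid X A) {α α' β β' : A} (ha : α = α') (hb : β = β')
    (h : G.source α = G.range β) (h' : G.source α' = G.range β') :
    G.mul α β h = G.mul α' β' h' := by
  subst ha hb; rfl

theorem IsCongruence.inv {G : ArrowGroupoid X A} {r : Setoid A} (hr : G.IsCongruence r)
    {α β : A} (h : r α β) : r (G.inv α) (G.inv β) := by
  have e1 : G.source (G.inv β) = G.range α := by rw [G.source_inv, hr.range_eq h]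
  have e2 : G.source β = G.range (G.inv α) := by rw [G.range_inv, hr.source_eq h]
  have e3 : G.source α = G.range (G.inv α) := by rw [G.range_inv]
  have k1 := hr.mul ((G.source_mul _ _ e1).trans e3)
    ((G.source_mul _ _ (G.source_inv β)).trans e2)
    (hr.mul e1 (G.source_inv β) (Setoid.refl _) h) (Setoid.refl (G.inv α))
  have l1 : G.mul (G.mul (G.inv β) α e1) (G.inv α) ((G.source_mul _ _ e1).trans e3)
      = G.inv β := by
    rw [G.mul_assoc _ _ _ e1 e3]
    refine (G.mul_congr rfl ((G.mul_inv α).trans ?_) _ (G.range_unit _).symm).trans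
      (G.mul_unit _)
    rw [e1]
  have l2 : G.mul (G.mul (G.inv β) β (G.source_inv β)) (G.inv α)
      ((G.source_mul _ _ (G.source_inv β)).trans e2) = G.inv α := by
    refine (G.mul_congr ((G.inv_mul β).trans ?_) rfl _ (G.source_unit _)).trans
      (G.unit_mul _)
    rw [e2]
  rw [l1, l2] at k1
  exact Setoid.symm k1

section Quot

variable (G : ArrowGroupoid X A) (r : Setoid A) (hr : G.IsCongruence r)

/-- The product of the quotient groupoid, computed on representatives. -/
noncomputable def quotientMul (α β : Quotient r)
    (h : Quotient.lift G.source (fun _ _ => hr.source_eq) α =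
      Quotient.lift G.range (fun _ _ => hr.range_eq) β) : Quotient r :=
  Quotient.mk r (G.mul α.out β.out (by
    rw [← Quotient.out_eq α, ← Quotient.out_eq β] at h
    exact h))

theorem quotientMul_mk (α β : A) (h : G.source α = G.range β) :
    G.quotientMul r hr (Quotient.mk r α) (Quotient.mk r β) h = Quotient.mk r (G.mul α β h) :=
  Quotient.sound (hr.mul _ _ (Quotient.mk_out α) (Quotient.mk_out β))

/-- The quotient of a groupoid by a congruence. -/
noncomputable def quotient : ArrowGroupoid X (Quotient r) where
  source := Quotient.lift G.source (fun _ _ => hr.source_eq)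
  range := Quotient.lift G.range (fun _ _ => hr.range_eq)
  unit x := Quotient.mk r (G.unit x)
  inv := Quotient.map G.inv (fun _ _ => hr.inv)
  mul := G.quotientMul r hr
  source_unit := G.source_unit
  range_unit := G.range_unit
  source_inv := by rintro ⟨α⟩; exact G.source_inv α
  range_inv := by rintro ⟨α⟩; exact G.range_inv α
  source_mul := by
    rintro ⟨α⟩ ⟨β⟩ h
    exact (congrArg _ (G.quotientMul_mk r hr α β h)).trans (G.source_mul α β h)
  range_mul := by
    rintro ⟨α⟩ ⟨β⟩ h
    exact (congrArg _ (G.quotientMul_mk r hr α β h)).trans (G.range_mul α β h)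
  unit_mul := by
    rintro ⟨α⟩
    exact (G.quotientMul_mk r hr _ α _).trans (congrArg _ (G.unit_mul α))
  mul_unit := by
    rintro ⟨α⟩
    exact (G.quotientMul_mk r hr α _ _).trans (congrArg _ (G.mul_unit α))
  mul_assoc := by
    rintro ⟨α⟩ ⟨β⟩ ⟨γ⟩ h k
    have h1 := G.quotientMul_mk r hr α β h
    have h2 := G.quotientMul_mk r hr β γ k
    have h3 := G.quotientMul_mk r hr (G.mul α β h) γ ((G.source_mul α β h).trans k)
    have h4 := G.quotientMul_mk r hr α (G.mul β γ k) (h.trans (G.range_mul β γ k).symm)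
    have h5 := congrArg (Quotient.mk r) (G.mul_assoc α β γ h k)
    have h6 := h3.trans (h5.trans h4.symm)
    simp only [← h1, ← h2] at h6
    exact h6
  inv_mul := by
    rintro ⟨α⟩
    exact (G.quotientMul_mk r hr _ α _).trans (congrArg _ (G.inv_mul α))
  mul_inv := by
    rintro ⟨α⟩
    exact (G.quotientMul_mk r hr α _ _).trans (congrArg _ (G.mul_inv α))

end Quot

/-- A map of arrows, identical on units, that is an isomorphism of topological groupoids. -/
structure IsTopologicalIso {B : Type*} [TopologicalSpace A] [TopologicalSpace B]
    (G : ArrowGroupoid X A) (H : ArrowGroupoid X B) (f : A → B) : Prop where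
  isHomeomorph : IsHomeomorph f
  source_eq : ∀ α, H.source (f α) = G.source α
  range_eq : ∀ α, H.range (f α) = G.range α
  map_mul : ∀ α β (h : G.source α = G.range β),
    f (G.mul α β h) = H.mul (f α) (f β) (by rw [source_eq, range_eq, h])

end ArrowGroupoid

/-! ### The left inverse hull of a left cancellative monoid -/

namespace LCMonoid

open scoped Classical in
/-- The left translation `t ↦ s * t` as a partial bijection, with inverse `s * t ↦ t`. -/
noncomputable def leftTranslation {S : Type*} [Monoid S] [IsLeftCancelMul S] (s : S) : S ≃. S where
  toFun t := some (s * t)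
  invFun u := if h : ∃ t, s * t = u then some h.choose else none
  inv t u := by
    constructor
    · intro h
      split_ifs at h with hu
      have := hu.choose_spec
      simp only [Option.some.injEq] at h
      rw [h] at this
      rw [this]
    · intro h
      simp only [Option.some.injEq] at h
      have hu : ∃ t, s * t = u := ⟨t, h⟩
      rw [dif_pos hu]
      exact congrArg some (mul_left_cancel (hu.choose_spec.trans h.symm))

/-- The partial bijections of `S` generated by the left translations under composition and
inversion. -/
inductive InHull {S : Type*} [Monoid S] [IsLeftCancelMul S] : (S ≃. S) → Prop
  | translation (s : S) : InHull (leftTranslation s)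
  | symm {g : S ≃. S} : InHull g → InHull g.symm
  | trans {g h : S ≃. S} : InHull g → InHull h → InHull (h.trans g)

/-- The left inverse hull of `S`. -/
structure Hull (S : Type*) [Monoid S] [IsLeftCancelMul S] where
  val : S ≃. S
  inHull : InHull val

section Hull

variable {S : Type*} [Monoid S] [IsLeftCancelMul S]

instance : CoeFun (Hull S) (fun _ => S → Option S) := ⟨fun g => g.1⟩

theorem Hull.val_injective {g h : Hull S} (H : g.1 = h.1) : g = h := by
  cases g; cases h; cases H; rfl

@[ext] theorem Hull.ext {g h : Hull S} (H : ∀ s, g s = h s) : g = h :=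
  Hull.val_injective (PEquiv.ext H)

theorem inHull_refl : InHull (PEquiv.refl S) := by
  have : PEquiv.refl S = leftTranslation (1 : S) := by
    ext1 s
    exact congrArg some (one_mul s).symm
  rw [this]
  exact InHull.translation 1

/-- The product `g * h` is the composition "first `h`, then `g`". -/
instance : Monoid (Hull S) where
  mul g h := ⟨h.1.trans g.1, InHull.trans g.2 h.2⟩
  one := ⟨PEquiv.refl S, inHull_refl⟩
  mul_assoc f g h := Hull.val_injective (PEquiv.trans_assoc h.1 g.1 f.1).symm
  one_mul g := Hull.val_injective (PEquiv.trans_refl g.1)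
  mul_one g := Hull.val_injective (PEquiv.refl_trans g.1)

instance : Inv (Hull S) := ⟨fun g => ⟨g.1.symm, InHull.symm g.2⟩⟩

theorem Hull.mul_eq_some {g h : Hull S} {s t : S} :
    (g * h) s = some t ↔ ∃ u, h s = some u ∧ g u = some t :=
  PEquiv.trans_eq_some h.1 g.1 s t

theorem Hull.inv_eq_some {g : Hull S} {s t : S} : g⁻¹ s = some t ↔ g t = some s :=
  PEquiv.eq_some_iff g.1

theorem Hull.one_apply (s : S) : (1 : Hull S) s = some s := rfl

theorem Hull.inj {g : Hull S} {s t u : S} (hs : g s = some u) (ht : g t = some u) : s = t :=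
  PEquiv.inj g.1 hs ht

theorem Hull.ext_some {g h : Hull S} (H : ∀ s t, g s = some t ↔ h s = some t) : g = h :=
  Hull.ext fun s => Option.ext fun t => H s t

/-- The domain of a partial bijection. -/
def Hull.dom (g : Hull S) : Set S := {s | ∃ t, g s = some t}

theorem isIdempotentElem_iff {p : Hull S} :
    IsIdempotentElem p ↔ ∀ s t, p s = some t → s = t := by
  constructor
  · intro hp s t hst
    have h1 : (p * p) s = some t := by rw [hp.eq]; exact hst
    obtain ⟨u, hu, hut⟩ := Hull.mul_eq_some.1 h1
    rw [hst] at hu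
    cases hu
    exact Hull.inj hst hut
  · intro hp
    refine Hull.ext_some fun s t => ?_
    rw [Hull.mul_eq_some]
    constructor
    · rintro ⟨u, hu, hut⟩
      rw [hp _ _ hu]; exact hut
    · intro h
      have := hp _ _ h
      subst this
      exact ⟨s, h, h⟩

end Hull

/-- The semigroup of idempotents of the left inverse hull. -/
structure Idem (S : Type*) [Monoid S] [IsLeftCancelMul S] where
  val : Hull S
  isIdempotentElem : IsIdempotentElem val

section Idem

variable {S : Type*} [Monoid S] [IsLeftCancelMul S]

theorem Idem.eq_some_iff (p : Idem S) {s t : S} : p.1 s = some t ↔ s = t ∧ s ∈ p.1.dom := by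
  constructor
  · intro h
    exact ⟨isIdempotentElem_iff.1 p.2 _ _ h, t, h⟩
  · rintro ⟨rfl, u, hu⟩
    have h := isIdempotentElem_iff.1 p.2 _ _ hu
    subst h
    exact hu

theorem Idem.ext_dom {p q : Idem S} (h : ∀ s, s ∈ p.1.dom ↔ s ∈ q.1.dom) : p = q := by
  have : p.1 = q.1 := Hull.ext_some fun s t => by rw [p.eq_some_iff, q.eq_some_iff, h]
  cases p; cases q; cases this; rfl

instance : Mul (Idem S) where
  mul p q := ⟨p.1 * q.1, isIdempotentElem_iff.2 fun s t h => by
    obtain ⟨u, hu, hut⟩ := Hull.mul_eq_some.1 h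
    exact (q.eq_some_iff.1 hu).1.trans (p.eq_some_iff.1 hut).1⟩

theorem Idem.mem_dom_mul {p q : Idem S} {s : S} :
    s ∈ (p * q).1.dom ↔ s ∈ p.1.dom ∧ s ∈ q.1.dom := by
  constructor
  · rintro ⟨t, ht⟩
    obtain ⟨u, hu, hut⟩ := Hull.mul_eq_some.1 ht
    obtain ⟨rfl, hq⟩ := q.eq_some_iff.1 hu
    exact ⟨⟨t, hut⟩, hq⟩
  · rintro ⟨hp, hq⟩
    exact ⟨s, Hull.mul_eq_some.2 ⟨s, q.eq_some_iff.2 ⟨rfl, hq⟩, p.eq_some_iff.2 ⟨rfl, hp⟩⟩⟩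

/-- The idempotent `g⁻¹ p g`. -/
def Idem.conj (g : Hull S) (p : Idem S) : Idem S :=
  ⟨g⁻¹ * p.1 * g, isIdempotentElem_iff.2 fun s t h => by
    obtain ⟨u, hu, h⟩ := Hull.mul_eq_some.1 h
    obtain ⟨v, hv, h⟩ := Hull.mul_eq_some.1 h
    obtain ⟨rfl, -⟩ := p.eq_some_iff.1 hv
    exact Hull.inj hu (Hull.inv_eq_some.1 h)⟩

theorem Idem.mem_dom_conj {g : Hull S} {p : Idem S} {s : S} :
    s ∈ (p.conj g).1.dom ↔ ∃ t, g s = some t ∧ t ∈ p.1.dom := by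
  constructor
  · rintro ⟨t, h⟩
    obtain ⟨u, hu, h⟩ := Hull.mul_eq_some.1 h
    obtain ⟨v, hv, h⟩ := Hull.mul_eq_some.1 h
    exact ⟨u, hu, v, hv⟩
  · rintro ⟨t, ht, hp⟩
    exact ⟨s, Hull.mul_eq_some.2 ⟨t, ht, Hull.mul_eq_some.2
      ⟨t, p.eq_some_iff.2 ⟨rfl, hp⟩, Hull.inv_eq_some.2 ht⟩⟩⟩

/-- The idempotent `g⁻¹ g`. -/
def Hull.domIdem (g : Hull S) : Idem S :=
  ⟨g⁻¹ * g, isIdempotentElem_iff.2 fun s t h => by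
    obtain ⟨u, hu, h⟩ := Hull.mul_eq_some.1 h
    exact Hull.inj hu (Hull.inv_eq_some.1 h)⟩

theorem Hull.mem_dom_domIdem {g : Hull S} {s : S} : s ∈ g.domIdem.1.dom ↔ s ∈ g.dom := by
  constructor
  · rintro ⟨t, h⟩
    obtain ⟨u, hu, h⟩ := Hull.mul_eq_some.1 h
    exact ⟨u, hu⟩
  · rintro ⟨t, ht⟩
    exact ⟨s, Hull.mul_eq_some.2 ⟨t, ht, Hull.inv_eq_some.2 ht⟩⟩

end Idem

/-! ### Constructible ideals -/

/-- The constructible right ideals `s₁⁻¹ t₁ ⋯ sₙ⁻¹ tₙ S`. -/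
inductive IsConstructible {S : Type*} [Monoid S] : Set S → Prop
  | univ : IsConstructible Set.univ
  | step (s t : S) {X : Set S} : IsConstructible X →
      IsConstructible {u | ∃ x ∈ X, s * u = t * x}

section Constructible

variable {S : Type*} [Monoid S] [IsLeftCancelMul S]

theorem IsConstructible.exists_range {X : Set S} (hX : IsConstructible X) :
    ∃ g : Hull S, ∀ u, u ∈ X ↔ ∃ x, g x = some u := by
  induction hX with
  | univ => exact ⟨1, fun u => ⟨fun _ => ⟨u, rfl⟩, fun _ => trivial⟩⟩
  | step s t _ ih =>
    obtain ⟨g, hg⟩ := ih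
    refine ⟨(Hull.mk _ (InHull.translation s))⁻¹ * (Hull.mk _ (InHull.translation t) * g), fun u => ?_⟩
    constructor
    · rintro ⟨x, hx, h⟩
      obtain ⟨y, hy⟩ := (hg x).1 hx
      refine ⟨y, Hull.mul_eq_some.2 ⟨t * x, Hull.mul_eq_some.2 ⟨x, hy, rfl⟩,
        Hull.inv_eq_some.2 (congrArg some h)⟩⟩
    · rintro ⟨y, hy⟩
      obtain ⟨v, hv, hy⟩ := Hull.mul_eq_some.1 hy
      obtain ⟨x, hx, hv⟩ := Hull.mul_eq_some.1 hv
      have h1 : some (s * u) = some v := Hull.inv_eq_some.1 hy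
      have h2 : some (t * x) = some v := hv
      exact ⟨x, (hg x).2 ⟨y, hx⟩, Option.some.inj (h1.trans h2.symm)⟩

theorem IsConstructible.exists_idem {X : Set S} (hX : IsConstructible X) :
    ∃ p : Idem S, p.1.dom = X := by
  obtain ⟨g, hg⟩ := hX.exists_range
  refine ⟨g⁻¹.domIdem, Set.ext fun u => ?_⟩
  rw [Hull.mem_dom_domIdem, hg]
  exact exists_congr fun x => Hull.inv_eq_some

/-- The idempotent `p_X` of a constructible ideal `X`, that is, the identity map of `X`. -/
noncomputable def idemOf (X : Set S) (hX : IsConstructible X) : Idem S := hX.exists_idem.choose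

theorem dom_idemOf {X : Set S} (hX : IsConstructible X) : (idemOf X hX).1.dom = X :=
  hX.exists_idem.choose_spec

theorem isConstructible_image {g : S ≃. S} (hg : InHull g) :
    ∀ X : Set S, IsConstructible X → IsConstructible {u | ∃ x ∈ X, g x = some u} ∧
      IsConstructible {u | ∃ x ∈ X, g.symm x = some u} := by
  induction hg with
  | translation s =>
    intro X hX
    constructor
    · convert hX.step 1 s using 3 with u
      refine exists_congr fun x => and_congr_right fun _ => ?_
      rw [one_mul, eq_comm (a := u)]
      exact Option.some_inj
    · convert hX.step s 1 using 3 with u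
      refine exists_congr fun x => and_congr_right fun _ => ?_
      rw [one_mul, PEquiv.eq_some_iff]
      exact Option.some_inj
  | symm _ ih =>
    intro X hX
    exact ⟨(ih X hX).2, (ih X hX).1⟩
  | @trans g h _ _ ihg ihh =>
    intro X hX
    constructor
    · convert (ihg _ (ihh X hX).1).1 using 3 with u
      simp only [PEquiv.trans_eq_some, Set.mem_ofPred_eq]
      constructor
      · rintro ⟨x, hx, b, hb, hu⟩; exact ⟨b, ⟨x, hx, hb⟩, hu⟩
      · rintro ⟨b, ⟨x, hx, hb⟩, hu⟩; exact ⟨x, hx, b, hb, hu⟩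
    · convert (ihh _ (ihg X hX).2).2 using 3 with u
      simp only [PEquiv.symm_trans_rev, PEquiv.trans_eq_some, Set.mem_ofPred_eq]
      constructor
      · rintro ⟨x, hx, b, hb, hu⟩; exact ⟨b, ⟨x, hx, hb⟩, hu⟩
      · rintro ⟨b, ⟨x, hx, hb⟩, hu⟩; exact ⟨x, hx, b, hb, hu⟩

theorem Idem.isConstructible_dom (p : Idem S) : IsConstructible p.1.dom := by
  convert (isConstructible_image p.1.2 _ IsConstructible.univ).1 using 1
  ext u
  constructor
  · intro hu
    exact ⟨u, trivial, p.eq_some_iff.2 ⟨rfl, hu⟩⟩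
  · rintro ⟨x, -, hx⟩
    obtain ⟨rfl, hx'⟩ := p.eq_some_iff.1 hx
    exact hx'

theorem idemOf_dom (p : Idem S) : idemOf p.1.dom p.isConstructible_dom = p :=
  Idem.ext_dom fun s => by rw [dom_idemOf]

theorem idemOf_congr {X : Set S} {p : Idem S} (hX : IsConstructible X) (h : p.1.dom = X) :
    idemOf X hX = p :=
  Idem.ext_dom fun s => by rw [dom_idemOf, h]

end Constructible

/-- Finite alignment: every intersection `sS ∩ tS` is a finitely generated right ideal. -/
def FinitelyAligned (S : Type*) [Monoid S] : Prop :=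
  ∀ s t : S, ∃ F : Set S, F.Finite ∧
    {u : S | (∃ v, u = s * v) ∧ ∃ v, u = t * v} = {u : S | ∃ f ∈ F, ∃ v, u = f * v}

/-- Strong C*-regularity. -/
def StronglyCStarRegular (S : Type*) [Monoid S] [IsLeftCancelMul S] : Prop :=
  ∀ (n m : ℕ) (h : Fin n → Hull S) (X : Set S) (X' : Fin m → Set S),
    IsConstructible X → (∀ i, IsConstructible (X' i)) →
    (X \ ⋃ i, X' i).Nonempty →
    X \ ⋃ i, X' i ⊆ ⋃ k, {s | h k s = some s} →
    ∃ (l : ℕ) (Y : Fin l → Set S) (hY : ∀ j, IsConstructible (Y j)) (k : Fin l → Fin n),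
      X \ ⋃ i, X' i ⊆ ⋃ j, Y j ∧
      ∀ j, h (k j) * (idemOf (Y j) (hY j)).1 = (idemOf (Y j) (hY j)).1

/-! ### Semi-characters -/

/-- The semi-characters of the semigroup of idempotents, with `{0, 1}` realized as `Bool`. -/
@[ext] structure SemiChar (S : Type*) [Monoid S] [IsLeftCancelMul S] where
  toFun : Idem S → Bool
  map_mul' : ∀ p q, toFun (p * q) = (toFun p && toFun q)
  ne_zero' : ∃ p, toFun p = true

section SemiChar

variable {S : Type*} [Monoid S] [IsLeftCancelMul S]

instance : CoeFun (SemiChar S) (fun _ => Idem S → Bool) := ⟨SemiChar.toFun⟩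

/-- The topology of pointwise convergence. -/
instance : TopologicalSpace (SemiChar S) := TopologicalSpace.induced SemiChar.toFun inferInstance

theorem SemiChar.mono (χ : SemiChar S) {p q : Idem S} (h : ∀ s, s ∈ p.1.dom → s ∈ q.1.dom)
    (hp : χ p = true) : χ q = true := by
  have : p = p * q := Idem.ext_dom fun s => by
    rw [Idem.mem_dom_mul]; exact ⟨fun hs => ⟨hs, h s hs⟩, fun hs => hs.1⟩
  rw [this, χ.map_mul', Bool.and_eq_true] at hp
  exact hp.2

theorem SemiChar.eq_of_inter (χ : SemiChar S) {p q r : Idem S} (hr : χ r = true)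
    (h : ∀ s ∈ r.1.dom, s ∈ p.1.dom ↔ s ∈ q.1.dom) : χ p = χ q := by
  have : p * r = q * r := Idem.ext_dom fun s => by
    rw [Idem.mem_dom_mul, Idem.mem_dom_mul]
    exact ⟨fun hs => ⟨(h s hs.2).1 hs.1, hs.2⟩, fun hs => ⟨(h s hs.2).2 hs.1, hs.2⟩⟩
  have := congrArg χ.toFun this
  simpa [χ.map_mul', hr] using this

theorem isOpen_eval (p : Idem S) (b : Bool) : IsOpen {χ : SemiChar S | χ p = b} := by
  have hc : Continuous (fun χ : SemiChar S => χ.toFun p) :=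
    (continuous_apply p).comp continuous_induced_dom
  exact (isOpen_discrete {b}).preimage hc

open scoped Classical in
/-- The semi-character `χ_s`, `χ_s(p_X) = 1` if and only if `s ∈ X`. -/
noncomputable def pointChar (s : S) : SemiChar S where
  toFun p := decide (s ∈ p.1.dom)
  map_mul' p q := by
    rw [Bool.eq_iff_iff]
    simp [Idem.mem_dom_mul]
  ne_zero' := ⟨⟨1, isIdempotentElem_iff.2 fun _ _ h => Option.some.inj h⟩,
    decide_eq_true ⟨s, rfl⟩⟩

theorem pointChar_eq_true {s : S} {p : Idem S} : pointChar s p = true ↔ s ∈ p.1.dom :=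
  by classical exact decide_eq_true_iff

theorem pointChar_eq_false {s : S} {p : Idem S} : pointChar s p = false ↔ s ∉ p.1.dom :=
  by classical exact decide_eq_false_iff_not

/-- The closure of the set of semi-characters `χ_s`. -/
def Omega (S : Type*) [Monoid S] [IsLeftCancelMul S] : Set (SemiChar S) :=
  closure (Set.range pointChar)

/-- The semi-character `χ(g⁻¹ · g)`. -/
def SemiChar.act (g : Hull S) (χ : SemiChar S) (h : χ g.domIdem = true) : SemiChar S where
  toFun p := χ (p.conj g)
  map_mul' p q := by
    rw [← χ.map_mul']
    congr 1
    refine Idem.ext_dom fun s => ?_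
    rw [Idem.mem_dom_mul]
    simp only [Idem.mem_dom_conj, Idem.mem_dom_mul]
    constructor
    · rintro ⟨t, ht, h1, h2⟩
      exact ⟨⟨t, ht, h1⟩, t, ht, h2⟩
    · rintro ⟨⟨t, ht, h1⟩, u, hu, h2⟩
      rw [ht] at hu
      cases hu
      exact ⟨t, ht, h1, h2⟩
  ne_zero' := by
    refine ⟨g⁻¹.domIdem, χ.mono (fun s hs => ?_) h⟩
    obtain ⟨t, ht⟩ := Hull.mem_dom_domIdem.1 hs
    exact Idem.mem_dom_conj.2 ⟨t, ht, Hull.mem_dom_domIdem.2 ⟨s, Hull.inv_eq_some.2 ht⟩⟩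

theorem act_mem_Omega {g : Hull S} {χ : SemiChar S} (h : χ g.domIdem = true)
    (hχ : χ ∈ Omega S) : χ.act g h ∈ Omega S := by
  rw [Omega, mem_closure_iff] at hχ ⊢
  intro V hV hmem
  obtain ⟨W, hW, rfl⟩ := isOpen_induced_iff.1 hV
  have hc : Continuous (fun ψ : SemiChar S => fun p : Idem S => ψ.toFun (p.conj g)) :=
    continuous_pi fun p => (continuous_apply (p.conj g)).comp continuous_induced_dom
  obtain ⟨_, ⟨h1, h2⟩, s, rfl⟩ := hχ _ ((hW.preimage hc).inter (isOpen_eval g.domIdem true))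
    ⟨hmem, h⟩
  obtain ⟨t, ht⟩ := Hull.mem_dom_domIdem.1 (pointChar_eq_true.1 h2)
  refine ⟨pointChar t, ?_, t, rfl⟩
  have : (pointChar t).toFun = fun p : Idem S => (pointChar s).toFun (p.conj g) := by
    funext p
    rw [Bool.eq_iff_iff, pointChar_eq_true, pointChar_eq_true, Idem.mem_dom_conj]
    simp [ht]
  rw [Set.mem_preimage, this]
  exact h1

end SemiChar

/-! ### The groupoid of the left inverse hull -/

/-- The set `Σ` of pairs `(g, χ)` with `χ(g⁻¹ g) = 1`. -/
structure PreArrow (S : Type*) [Monoid S] [IsLeftCancelMul S] where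
  elt : Hull S
  char : SemiChar S
  char_dom : char elt.domIdem = true

section Paterson

variable {S : Type*} [Monoid S] [IsLeftCancelMul S]

/-- `(g₁, χ₁) ∼ (g₂, χ₂)` if `χ₁ = χ₂` and `g₁ p = g₂ p` for some idempotent `p` with
`χ₁(p) = 1`. -/
def PreArrow.Rel (a b : PreArrow S) : Prop :=
  a.char = b.char ∧ ∃ p : Idem S, a.elt * p.1 = b.elt * p.1 ∧ a.char p = true

theorem Hull.mul_idem_eq_iff {g h : Hull S} {p : Idem S} :
    g * p.1 = h * p.1 ↔ ∀ s ∈ p.1.dom, g s = h s := by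
  have key : ∀ (g : Hull S) (s t : S),
      (g * p.1) s = some t ↔ s ∈ p.1.dom ∧ g s = some t := by
    intro g s t
    rw [Hull.mul_eq_some]
    constructor
    · rintro ⟨u, hu, hut⟩
      obtain ⟨rfl, hs⟩ := p.eq_some_iff.1 hu
      exact ⟨hs, hut⟩
    · rintro ⟨hs, h⟩
      exact ⟨s, p.eq_some_iff.2 ⟨rfl, hs⟩, h⟩
  constructor
  · intro H s hs
    refine Option.ext fun t => ?_
    have h1 := key g s t
    have h2 := key h s t
    rw [H] at h1
    exact (iff_of_eq (by simp [hs])).trans (h1.symm.trans (h2.trans (by simp [hs])))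
  · intro H
    refine Hull.ext_some fun s t => ?_
    rw [key, key]
    exact and_congr_right fun hs => by rw [H s hs]

instance patersonSetoid (S : Type*) [Monoid S] [IsLeftCancelMul S] : Setoid (PreArrow S) where
  r := PreArrow.Rel
  iseqv :=
    { refl := fun a => ⟨rfl, a.elt.domIdem, rfl, a.char_dom⟩
      symm := by
        rintro a b ⟨h, p, hp, hχ⟩
        exact ⟨h.symm, p, hp.symm, h ▸ hχ⟩
      trans := by
        rintro a b c ⟨h, p, hp, hχ⟩ ⟨h', q, hq, hχ'⟩
        refine ⟨h.trans h', p * q, ?_, ?_⟩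
        · rw [Hull.mul_idem_eq_iff] at *
          intro s hs
          obtain ⟨h1, h2⟩ := Idem.mem_dom_mul.1 hs
          exact (hp s h1).trans (hq s h2)
        · rw [a.char.map_mul', hχ, h, hχ']
          rfl }

/-- The arrows `[g, χ]` of the groupoid of the inverse semigroup `I_ℓ(S)`. -/
def PatersonArrow (S : Type*) [Monoid S] [IsLeftCancelMul S] : Type _ :=
  Quotient (patersonSetoid S)

/-- The arrow `[g, χ]`. -/
def arrow (g : Hull S) (χ : SemiChar S) (h : χ g.domIdem = true) : PatersonArrow S :=
  Quotient.mk (patersonSetoid S) ⟨g, χ, h⟩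

/-- The set `D(g, U)`, for `U` contained in `{χ | χ(g⁻¹ g) = 1}`. -/
def basicSet (g : Hull S) (U : Set (SemiChar S)) : Set (PatersonArrow S) :=
  {γ | ∃ χ ∈ U, ∃ h : χ g.domIdem = true, γ = arrow g χ h}

/-- The topology with basis the sets `D(g, U)`, where `U` is an open subset of
`{χ | χ(g⁻¹ g) = 1}`. -/
instance : TopologicalSpace (PatersonArrow S) :=
  TopologicalSpace.generateFrom
    {V | ∃ (g : Hull S) (U : Set (SemiChar S)),
      IsOpen U ∧ U ⊆ {χ | χ g.domIdem = true} ∧ V = basicSet g U}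

theorem arrow_eq_iff {g h : Hull S} {χ ψ : SemiChar S} {hg : χ g.domIdem = true}
    {hh : ψ h.domIdem = true} :
    arrow g χ hg = arrow h ψ hh ↔
      χ = ψ ∧ ∃ p : Idem S, g * p.1 = h * p.1 ∧ χ p = true :=
  Quotient.eq (r := patersonSetoid S)

theorem act_eq_of_rel {a b : PreArrow S} (h : PreArrow.Rel a b) :
    a.char.act a.elt a.char_dom = b.char.act b.elt b.char_dom := by
  obtain ⟨g, χ, hg⟩ := a
  obtain ⟨g', χ', hg'⟩ := b
  obtain ⟨e, p, hp, hχ⟩ := h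
  dsimp only at e hp hχ
  subst e
  rw [Hull.mul_idem_eq_iff] at hp
  refine SemiChar.ext (funext fun q => ?_)
  refine χ.eq_of_inter hχ fun s hs => ?_
  rw [Idem.mem_dom_conj, Idem.mem_dom_conj, hp s hs]

theorem char_mul_dom {g h : Hull S} {ψ : SemiChar S} (hh : ψ h.domIdem = true)
    (hg : (ψ.act h hh) g.domIdem = true) : ψ (g * h).domIdem = true := by
  refine ψ.mono (p := g.domIdem.conj h) (fun s hs => ?_) hg
  obtain ⟨t, ht, hd⟩ := Idem.mem_dom_conj.1 hs
  obtain ⟨u, hu⟩ := Hull.mem_dom_domIdem.1 hd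
  exact Hull.mem_dom_domIdem.2 ⟨u, Hull.mul_eq_some.2 ⟨t, ht, hu⟩⟩

theorem act_inv_dom {g : Hull S} {χ : SemiChar S} (h : χ g.domIdem = true) :
    (χ.act g h) g⁻¹.domIdem = true := by
  refine χ.mono (fun s hs => ?_) h
  obtain ⟨t, ht⟩ := Hull.mem_dom_domIdem.1 hs
  exact Idem.mem_dom_conj.2 ⟨t, ht, Hull.mem_dom_domIdem.2 ⟨s, Hull.inv_eq_some.2 ht⟩⟩

/-- The source `χ` of `[g, χ]`. -/
def PatersonArrow.source : PatersonArrow S → SemiChar S :=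
  Quotient.lift PreArrow.char fun _ _ h => h.1

/-- The range `χ(g⁻¹ · g)` of `[g, χ]`. -/
def PatersonArrow.range : PatersonArrow S → SemiChar S :=
  Quotient.lift (fun a => a.char.act a.elt a.char_dom) fun _ _ h => act_eq_of_rel h

theorem one_dom (χ : SemiChar S) : χ (1 : Hull S).domIdem = true := by
  obtain ⟨p, hp⟩ := χ.ne_zero'
  exact χ.mono (fun s _ => Hull.mem_dom_domIdem.2 ⟨s, rfl⟩) hp

theorem act_one (χ : SemiChar S) : χ.act 1 (one_dom χ) = χ := by
  refine SemiChar.ext (funext fun p => congrArg χ.toFun (Idem.ext_dom fun s => ?_))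
  rw [Idem.mem_dom_conj]
  simp [Hull.one_apply]

theorem act_mul {g h : Hull S} {ψ : SemiChar S} (hh : ψ h.domIdem = true)
    (hg : (ψ.act h hh) g.domIdem = true) :
    ψ.act (g * h) (char_mul_dom hh hg) = (ψ.act h hh).act g hg := by
  refine SemiChar.ext (funext fun p => congrArg ψ.toFun (Idem.ext_dom fun s => ?_))
  simp only [Idem.mem_dom_conj, Hull.mul_eq_some]
  constructor
  · rintro ⟨t, ⟨u, hu, hut⟩, ht⟩; exact ⟨u, hu, t, hut, ht⟩
  · rintro ⟨u, hu, t, hut, ht⟩; exact ⟨t, ⟨u, hu, hut⟩, ht⟩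

theorem act_inv {g : Hull S} {χ : SemiChar S} (h : χ g.domIdem = true) :
    (χ.act g h).act g⁻¹ (act_inv_dom h) = χ := by
  refine SemiChar.ext (funext fun p => χ.eq_of_inter h fun s hs => ?_)
  obtain ⟨t, ht⟩ := Hull.mem_dom_domIdem.1 hs
  simp only [Idem.mem_dom_conj, ht, Option.some.injEq, Hull.inv_eq_some]
  constructor
  · rintro ⟨_, rfl, u, hu, hp⟩
    rw [Hull.inj ht hu]; exact hp
  · intro hp; exact ⟨t, rfl, s, ht, hp⟩

theorem arrow_congr {g g' : Hull S} {χ χ' : SemiChar S} (hg : g = g') (hχ : χ = χ')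
    (h : χ g.domIdem = true) (h' : χ' g'.domIdem = true) : arrow g χ h = arrow g' χ' h' := by
  subst hg hχ; rfl

/-- The inverse `[g⁻¹, χ(g⁻¹ · g)]` of `[g, χ]`. -/
def PatersonArrow.inv : PatersonArrow S → PatersonArrow S :=
  Quotient.lift (fun a => arrow a.elt⁻¹ (a.char.act a.elt a.char_dom) (act_inv_dom a.char_dom)) (by
    intro a b hab
    refine arrow_eq_iff.2 ⟨act_eq_of_rel hab, ?_⟩
    obtain ⟨h, p, hp, hχ⟩ := hab
    rw [Hull.mul_idem_eq_iff] at hp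
    refine ⟨(p * a.elt.domIdem).conj a.elt⁻¹, ?_, ?_⟩
    · rw [Hull.mul_idem_eq_iff]
      intro s hs
      obtain ⟨t, ht, hd⟩ := Idem.mem_dom_conj.1 hs
      rw [ht]
      symm
      rw [Hull.inv_eq_some] at ht ⊢
      rw [← hp t (Idem.mem_dom_mul.1 hd).1, ht]
    · have h1 : a.char (p * a.elt.domIdem) = true := by
        rw [a.char.map_mul', hχ, a.char_dom]; rfl
      refine a.char.mono (fun s hs => ?_) h1
      obtain ⟨t, ht⟩ := Hull.mem_dom_domIdem.1 (Idem.mem_dom_mul.1 hs).2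
      exact Idem.mem_dom_conj.2 ⟨t, ht, Idem.mem_dom_conj.2 ⟨s, Hull.inv_eq_some.2 ht, hs⟩⟩)

theorem PatersonArrow.composable {a b : PreArrow S}
    (h : a.char = b.char.act b.elt b.char_dom) : b.char (a.elt * b.elt).domIdem = true :=
  char_mul_dom b.char_dom (h ▸ a.char_dom)

/-- The product `[g, χ] [h, ψ] = [gh, ψ]`, defined if `χ = ψ(h⁻¹ · h)`; it is computed on
representatives and does not depend on them by the lemma that follows. -/
noncomputable def PatersonArrow.mul (γ δ : PatersonArrow S) (h : γ.source = δ.range) :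
    PatersonArrow S :=
  arrow (γ.out.elt * δ.out.elt) δ.out.char (PatersonArrow.composable (by
    rw [← Quotient.out_eq γ, ← Quotient.out_eq δ] at h
    exact h))

theorem PatersonArrow.mul_arrow {g k : Hull S} {χ ψ : SemiChar S} (hg : χ g.domIdem = true)
    (hk : ψ k.domIdem = true) (h : χ = ψ.act k hk) :
    PatersonArrow.mul (arrow g χ hg) (arrow k ψ hk) h =
      arrow (g * k) ψ (char_mul_dom hk (h ▸ hg)) := by
  refine arrow_eq_iff.2 ?_
  obtain ⟨e1, p, hp, hpχ⟩ : PreArrow.Rel (Quotient.out (arrow g χ hg)) ⟨g, χ, hg⟩ :=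
    Quotient.mk_out (s := patersonSetoid S) (⟨g, χ, hg⟩ : PreArrow S)
  obtain ⟨e2, q, hq, hqψ⟩ : PreArrow.Rel (Quotient.out (arrow k ψ hk)) ⟨k, ψ, hk⟩ :=
    Quotient.mk_out (s := patersonSetoid S) (⟨k, ψ, hk⟩ : PreArrow S)
  dsimp only at e1 hp hpχ e2 hq hqψ
  rw [e1, h] at hpχ
  rw [e2] at hqψ
  refine ⟨e2, p.conj k * q, ?_, ?_⟩
  · rw [Hull.mul_idem_eq_iff] at *
    intro s hs
    obtain ⟨h1, h2⟩ := Idem.mem_dom_mul.1 hs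
    obtain ⟨t, ht, hd⟩ := Idem.mem_dom_conj.1 h1
    refine Option.ext fun u => ?_
    have := (hq s h2).trans ht
    rw [Hull.mul_eq_some, Hull.mul_eq_some, this, ht]
    simp only [Option.some.injEq, exists_eq_left', hp t hd]
  · have : ψ (p.conj k) = true := hpχ
    rw [e2, ψ.map_mul', this, hqψ]
    rfl

/-- The groupoid of the inverse semigroup `I_ℓ(S)`, with unit space the semi-characters. -/
noncomputable def patersonGroupoid (S : Type*) [Monoid S] [IsLeftCancelMul S] :
    ArrowGroupoid (SemiChar S) (PatersonArrow S) where
  source := PatersonArrow.source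
  range := PatersonArrow.range
  unit χ := arrow 1 χ (one_dom χ)
  inv := PatersonArrow.inv
  mul := PatersonArrow.mul
  source_unit _ := rfl
  range_unit χ := act_one χ
  source_inv := by rintro ⟨a⟩; rfl
  range_inv := by rintro ⟨a⟩; exact act_inv a.char_dom
  source_mul := by
    rintro ⟨g, χ, hg⟩ ⟨k, ψ, hk⟩ h
    exact (congrArg PatersonArrow.source (PatersonArrow.mul_arrow hg hk h)).trans rfl
  range_mul := by
    rintro ⟨g, χ, hg⟩ ⟨k, ψ, hk⟩ h
    refine (congrArg PatersonArrow.range (PatersonArrow.mul_arrow hg hk h)).trans ?_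
    have h' : χ = ψ.act k hk := h
    subst h'
    exact act_mul hk hg
  unit_mul := by
    rintro ⟨g, χ, hg⟩
    exact (PatersonArrow.mul_arrow (one_dom _) hg rfl).trans
      (arrow_congr (one_mul g) rfl _ hg)
  mul_unit := by
    rintro ⟨g, χ, hg⟩
    exact (PatersonArrow.mul_arrow hg (one_dom _) (act_one χ).symm).trans
      (arrow_congr (mul_one g) rfl _ hg)
  mul_assoc := by
    rintro ⟨f, φ, hf⟩ ⟨g, χ, hg⟩ ⟨k, ψ, hk⟩ h1 h2
    have h1' : φ = χ.act g hg := h1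
    have h2' : χ = ψ.act k hk := h2
    subst h1' h2'
    have a1 := PatersonArrow.mul_arrow hf hg rfl
    have a2 := PatersonArrow.mul_arrow hg hk rfl
    have a3 := PatersonArrow.mul_arrow (char_mul_dom hg hf) hk rfl
    have a4 := PatersonArrow.mul_arrow hf (char_mul_dom hk hg) (act_mul hk hg).symm
    have a5 := a3.trans ((arrow_congr (mul_assoc f g k) rfl _ _).trans a4.symm)
    simp only [← a1, ← a2] at a5
    exact a5
  inv_mul := by
    rintro ⟨g, χ, hg⟩
    refine (PatersonArrow.mul_arrow (act_inv_dom hg) hg rfl).trans ?_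
    refine arrow_eq_iff.2 ⟨rfl, g.domIdem, ?_, hg⟩
    rw [one_mul]
    exact g.domIdem.2
  mul_inv := by
    rintro ⟨g, χ, hg⟩
    refine (PatersonArrow.mul_arrow hg (act_inv_dom hg) (act_inv hg).symm).trans ?_
    refine arrow_eq_iff.2 ⟨rfl, g⁻¹.domIdem, ?_, act_inv_dom hg⟩
    rw [one_mul]
    exact g⁻¹.domIdem.2

theorem range_mem_Omega (γ : PatersonArrow S) (h : γ.source ∈ Omega S) : γ.range ∈ Omega S := by
  obtain ⟨g, χ, hg⟩ := γ
  exact act_mem_Omega hg h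

end Paterson

/-! ### The groupoids `𝒢_P(S)` and `𝒢(S)` -/

/-- The arrows of `𝒢_P(S)`, the restriction to the closed invariant set `Ω(S)`, with the subspace
topology. -/
abbrev GPArrow (S : Type*) [Monoid S] [IsLeftCancelMul S] : Type _ :=
  {γ : PatersonArrow S // (patersonGroupoid S).source γ ∈ Omega S}

/-- The groupoid `𝒢_P(S)`. -/
noncomputable def groupoidP (S : Type*) [Monoid S] [IsLeftCancelMul S] :
    ArrowGroupoid (Omega S) (GPArrow S) :=
  (patersonGroupoid S).restrict (Omega S) range_mem_Omega

section Spielberg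

variable {S : Type*} [Monoid S] [IsLeftCancelMul S]

/-- The extension of a semi-character to sets of the form `Y = X \ (X₁ ∪ ⋯ ∪ X_m)` with
constructible `X`, `X_i` takes the value one at `Y`. -/
def SemiChar.IsOneAt (χ : SemiChar S) (Y : Set S) : Prop :=
  ∃ (X : Set S) (hX : IsConstructible X) (F : Set (Set S)) (hF : ∀ Z ∈ F, IsConstructible Z),
    F.Finite ∧ Y = X \ ⋃₀ F ∧ χ (idemOf X hX) = true ∧
      ∀ (Z : Set S) (hZ : Z ∈ F), χ (idemOf Z (hF Z hZ)) = false

theorem SemiChar.isOneAt_dom (χ : SemiChar S) {p : Idem S} (hp : χ p = true) :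
    χ.IsOneAt p.1.dom :=
  ⟨p.1.dom, p.isConstructible_dom, ∅, by simp, Set.finite_empty, by simp,
    by rw [idemOf_dom]; exact hp, by simp⟩

theorem SemiChar.IsOneAt.inter {χ : SemiChar S} {Y Z : Set S} (hY : χ.IsOneAt Y)
    (hZ : χ.IsOneAt Z) : χ.IsOneAt (Y ∩ Z) := by
  obtain ⟨X, hX, F, hF, fF, rfl, h1, h2⟩ := hY
  obtain ⟨X', hX', F', hF', fF', rfl, h1', h2'⟩ := hZ
  have hd : (idemOf X hX * idemOf X' hX').1.dom = X ∩ X' := by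
    ext s; rw [Idem.mem_dom_mul, dom_idemOf, dom_idemOf]; rfl
  refine ⟨X ∩ X', hd ▸ Idem.isConstructible_dom _, F ∪ F',
    fun W hW => hW.elim (hF W) (hF' W), fF.union fF', ?_, ?_, ?_⟩
  · ext s
    simp only [Set.mem_inter_iff, Set.mem_sdiff, Set.sUnion_union, Set.mem_union]
    tauto
  · rw [idemOf_congr _ hd, χ.map_mul', h1, h1']; rfl
  · rintro W (hW | hW)
    · exact h2 W hW
    · exact h2' W hW

theorem SemiChar.IsOneAt.preimage {χ : SemiChar S} {g : Hull S} {hg : χ g.domIdem = true}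
    {Y : Set S} (hY : (χ.act g hg).IsOneAt Y) :
    χ.IsOneAt {s | ∃ t ∈ Y, g s = some t} := by
  obtain ⟨X, hX, F, hF, fF, rfl, h1, h2⟩ := hY
  have hd : ∀ (Z : Set S) (hZ : IsConstructible Z),
      ((idemOf Z hZ).conj g).1.dom = {s | ∃ t ∈ Z, g s = some t} := by
    intro Z hZ
    ext s
    rw [Idem.mem_dom_conj, dom_idemOf]
    exact exists_congr fun t => and_comm
  refine ⟨{s | ∃ t ∈ X, g s = some t}, hd X hX ▸ Idem.isConstructible_dom _,
    (fun Z => {s | ∃ t ∈ Z, g s = some t}) '' F, ?_, fF.image _, ?_, ?_, ?_⟩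
  · rintro _ ⟨Z, hZ, rfl⟩
    have h3 := Idem.isConstructible_dom ((idemOf Z (hF Z hZ)).conj g)
    rw [hd Z (hF Z hZ)] at h3
    exact h3
  · ext s
    simp only [Set.mem_sdiff, Set.mem_ofPred_eq, Set.mem_sUnion, Set.mem_image]
    constructor
    · rintro ⟨t, ⟨hX, hF⟩, ht⟩
      refine ⟨⟨t, hX, ht⟩, ?_⟩
      rintro ⟨_, ⟨Z, hZ, rfl⟩, u, hu, hsu⟩
      rw [ht] at hsu
      cases hsu
      exact hF ⟨Z, hZ, hu⟩
    · rintro ⟨⟨t, hX, ht⟩, hF⟩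
      exact ⟨t, ⟨hX, fun ⟨Z, hZ, hu⟩ => hF ⟨_, ⟨Z, hZ, rfl⟩, t, hu, ht⟩⟩, ht⟩
  · rw [idemOf_congr _ (hd X hX)]
    exact h1
  · rintro _ ⟨Z, hZ, rfl⟩
    rw [idemOf_congr _ (hd Z (hF Z hZ))]
    exact h2 Z hZ

theorem SemiChar.IsOneAt.isOpen_exists {χ : SemiChar S} {Y : Set S} (hY : χ.IsOneAt Y) :
    ∃ U : Set (SemiChar S), IsOpen U ∧ χ ∈ U ∧ ∀ s, pointChar s ∈ U → s ∈ Y := by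
  obtain ⟨X, hX, F, hF, fF, rfl, h1, h2⟩ := hY
  refine ⟨{ψ | ψ (idemOf X hX) = true} ∩
    ⋂ Z ∈ F, {ψ | ∃ hZ : IsConstructible Z, ψ (idemOf Z hZ) = false}, ?_, ⟨h1, ?_⟩, ?_⟩
  · refine (isOpen_eval _ _).inter (fF.isOpen_biInter fun Z hZ => ?_)
    convert isOpen_eval (idemOf Z (hF Z hZ)) false using 3
    exact ⟨fun ⟨_, h⟩ => h, fun h => ⟨_, h⟩⟩
  · simp only [Set.mem_iInter]
    exact fun Z hZ => ⟨hF Z hZ, h2 Z hZ⟩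
  · rintro s ⟨h3, h4⟩
    simp only [Set.mem_iInter] at h4
    have := pointChar_eq_true.1 h3
    rw [dom_idemOf] at this
    refine ⟨this, ?_⟩
    rintro ⟨Z, hZ, hs⟩
    obtain ⟨hc, h5⟩ := h4 Z hZ
    have := pointChar_eq_false.1 h5
    rw [dom_idemOf] at this
    exact this hs

/-- `[g, χ] ∼ [h, χ]` if `g` and `h` coincide on a set `Y = X \ (X₁ ∪ ⋯ ∪ X_m)`, with constructible
`X`, `X_i`, such that `χ(p_Y) = 1`. -/
def PatersonArrow.Sim (γ δ : PatersonArrow S) : Prop :=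
  ∃ (χ : SemiChar S) (g h : Hull S) (hg : χ g.domIdem = true) (hh : χ h.domIdem = true),
    γ = arrow g χ hg ∧ δ = arrow h χ hh ∧ ∃ Y : Set S, χ.IsOneAt Y ∧ ∀ s ∈ Y, g s = h s

theorem PatersonArrow.sim_arrow {g h : Hull S} {χ ψ : SemiChar S} {hg : χ g.domIdem = true}
    {hh : ψ h.domIdem = true} : PatersonArrow.Sim (arrow g χ hg) (arrow h ψ hh) ↔
      χ = ψ ∧ ∃ Y : Set S, χ.IsOneAt Y ∧ ∀ s ∈ Y, g s = h s := by
  constructor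
  · rintro ⟨φ, g', h', hg', hh', e1, e2, Y, hY, H⟩
    obtain ⟨rfl, p, hp, hpχ⟩ := arrow_eq_iff.1 e1
    obtain ⟨rfl, q, hq, hqχ⟩ := arrow_eq_iff.1 e2
    rw [Hull.mul_idem_eq_iff] at hp hq
    refine ⟨rfl, _, (hY.inter (SemiChar.isOneAt_dom _ hpχ)).inter (SemiChar.isOneAt_dom _ hqχ), ?_⟩
    rintro s ⟨⟨h1, h2⟩, h3⟩
    rw [hp s h2, hq s h3, H s h1]
  · rintro ⟨rfl, Y, hY, H⟩
    exact ⟨χ, g, h, hg, hh, rfl, rfl, Y, hY, H⟩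

/-- The relation `∼` on `𝒢_P(S)`. -/
def simSetoid (S : Type*) [Monoid S] [IsLeftCancelMul S] : Setoid (GPArrow S) where
  r γ δ := PatersonArrow.Sim γ.1 δ.1
  iseqv :=
    { refl := by
        rintro ⟨⟨g, χ, hg⟩, h⟩
        exact PatersonArrow.sim_arrow.2 ⟨rfl, _, SemiChar.isOneAt_dom _ hg, fun _ _ => rfl⟩
      symm := by
        rintro γ δ ⟨χ, g, h, hg, hh, e1, e2, Y, hY, H⟩
        exact ⟨χ, h, g, hh, hg, e2, e1, Y, hY, fun s hs => (H s hs).symm⟩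
      trans := by
        rintro ⟨⟨g, χ, hg⟩, h1⟩ ⟨⟨k, ψ, hk⟩, h2⟩ ⟨⟨l, φ, hl⟩, h3⟩ h12 h23
        obtain ⟨rfl, Y, hY, H⟩ := PatersonArrow.sim_arrow.1 h12
        obtain ⟨rfl, Z, hZ, K⟩ := PatersonArrow.sim_arrow.1 h23
        exact PatersonArrow.sim_arrow.2 ⟨rfl, _, hY.inter hZ,
          fun s hs => (H s hs.1).trans (K s hs.2)⟩ }

theorem act_eq_of_isOneAt {g h : Hull S} {χ : SemiChar S} (hχ : χ ∈ Omega S)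
    (hg : χ g.domIdem = true) (hh : χ h.domIdem = true) {Y : Set S} (hY : χ.IsOneAt Y)
    (H : ∀ s ∈ Y, g s = h s) : χ.act g hg = χ.act h hh := by
  refine SemiChar.ext (funext fun p => ?_)
  change χ (p.conj g) = χ (p.conj h)
  obtain ⟨U, hU, hχU, hUY⟩ := hY.isOpen_exists
  obtain ⟨_, ⟨⟨h1, h2⟩, h3⟩, s, rfl⟩ := mem_closure_iff.1 hχ _
    ((hU.inter (isOpen_eval (p.conj g) (χ (p.conj g)))).inter
      (isOpen_eval (p.conj h) (χ (p.conj h)))) ⟨⟨hχU, rfl⟩, rfl⟩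
  have hs := H s (hUY s h1)
  have h2' : pointChar s (p.conj g) = χ (p.conj g) := h2
  have h3' : pointChar s (p.conj h) = χ (p.conj h) := h3
  rw [← h2', ← h3', Bool.eq_iff_iff, pointChar_eq_true, pointChar_eq_true,
    Idem.mem_dom_conj, Idem.mem_dom_conj, hs]

theorem sim_isCongruence (S : Type*) [Monoid S] [IsLeftCancelMul S] :
    (groupoidP S).IsCongruence (simSetoid S) where
  source_eq := by
    rintro ⟨⟨g, χ, hg⟩, h1⟩ ⟨⟨k, ψ, hk⟩, h2⟩ h
    exact Subtype.ext (PatersonArrow.sim_arrow.1 h).1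
  range_eq := by
    rintro ⟨⟨g, χ, hg⟩, h1⟩ ⟨⟨k, ψ, hk⟩, h2⟩ h
    obtain ⟨rfl, Y, hY, H⟩ := PatersonArrow.sim_arrow.1 h
    exact Subtype.ext (act_eq_of_isOneAt h1 hg hk hY H)
  mul := by
    rintro ⟨⟨g, χ, hg⟩, h1⟩ ⟨⟨g', χ', hg'⟩, h1'⟩ ⟨⟨k, ψ, hk⟩, h2⟩ ⟨⟨k', ψ', hk'⟩, h2'⟩ h h' hα hβ
    obtain ⟨rfl, Y, hY, H⟩ := PatersonArrow.sim_arrow.1 hα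
    obtain ⟨rfl, Z, hZ, K⟩ := PatersonArrow.sim_arrow.1 hβ
    have e : χ = ψ.act k hk := congrArg Subtype.val h
    have e' : χ = ψ.act k' hk' := congrArg Subtype.val h'
    change PatersonArrow.Sim (PatersonArrow.mul (arrow g χ hg) (arrow k ψ hk) e)
      (PatersonArrow.mul (arrow g' χ hg') (arrow k' ψ hk') e')
    rw [PatersonArrow.mul_arrow, PatersonArrow.mul_arrow, PatersonArrow.sim_arrow]
    rw [e] at hY
    refine ⟨rfl, _, hY.preimage.inter hZ, ?_⟩
    rintro s ⟨⟨t, ht, hst⟩, hs⟩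
    have hst' := (K s hs).symm.trans hst
    refine Option.ext fun u => ?_
    rw [Hull.mul_eq_some, Hull.mul_eq_some, hst, hst']
    simp only [Option.some.injEq, exists_eq_left', H t ht]

end Spielberg

/-- The arrows of `𝒢(S) = 𝒢_P(S)/∼`, with the quotient topology. -/
abbrev GArrow (S : Type*) [Monoid S] [IsLeftCancelMul S] : Type _ := Quotient (simSetoid S)

/-- The groupoid `𝒢(S)`. -/
noncomputable def groupoid (S : Type*) [Monoid S] [IsLeftCancelMul S] :
    ArrowGroupoid (Omega S) (GArrow S) :=
  (groupoidP S).quotient (simSetoid S) (sim_isCongruence S)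

/-- The canonical map `𝒢_P(S) → 𝒢(S)`. -/
def canonicalMap (S : Type*) [Monoid S] [IsLeftCancelMul S] : GPArrow S → GArrow S :=
  Quotient.mk (simSetoid S)

/-! ### The monoid -/

/-- The generators `a`, `b`, `x_n`, `y_n`, `n ∈ ℤ`. -/
inductive Gen : Type
  | a : Gen
  | b : Gen
  | x (n : ℤ) : Gen
  | y (n : ℤ) : Gen

open FreeMonoid in
/-- The relations `a b x_n = b x_n` and `a b y_n = b y_{n+1}`, `n ∈ ℤ`. -/
inductive GenRel : FreeMonoid Gen → FreeMonoid Gen → Prop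
  | x (n : ℤ) : GenRel (of Gen.a * of Gen.b * of (Gen.x n)) (of Gen.b * of (Gen.x n))
  | y (n : ℤ) : GenRel (of Gen.a * of Gen.b * of (Gen.y n)) (of Gen.b * of (Gen.y (n + 1)))

/-- The monoid `⟨a, b, x_n, y_n : a b x_n = b x_n, a b y_n = b y_{n+1}⟩`. -/
abbrev ExampleMonoid : Type := PresentedMonoid GenRel

end LCMonoid

/-! Read from left to right, the relations are rewriting rules on a leading `a`: it disappears in
front of `b x_n` and raises the index in front of `b y_n`. Letting generators act on words by these
rules gives a normal form. Each generator acts injectively, whence left cancellation. Comparing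
first letters shows that `aS ∩ bS = b D`, where `D = xyIdeal` is the union of all `x_n S` and `y_n
S`, and that `b⁻¹ a b` is a bijection σ of `D` which fixes every `x_n z` and sends `y_n z` to
`y_{n+1} z` (`gen_a_mul_eq_gen_b_mul`). Since `D` has infinitely many mutually independent
generators, `S` is not finitely aligned.

Every element of the left inverse hull is empty or equal to `t s⁻¹` or `t σ^k s⁻¹`
(`isTranslate_hull`), so the nonempty constructible ideals are `tS` and `tD`
(`isConstructible_cases`). A constructible ideal either contains `D` or meets it inside one `cS`
with `c` a generator (`xyIdeal_subset_or`). Finitely many ideals that do not cover `tD` therefore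
leave infinitely many `t y_j`. By the pigeonhole principle one `h_k` fixes two of them, and then all
of `tD` (`hull_fix_xyIdeal`). This is strong C*-regularity with the single ideal `Y = X`; for `X =
tS` it is enough to look at the point `t`.

For any monoid, strong C*-regularity and density of the `χ_s` in `Ω(S)` make `∼` trivial, so the
quotient map is an isomorphism. The groupoid is not Hausdorff because `χ_{x_n}` tends to the
character `limitChar` of ideals containing `D`: the arrows `[σ, χ_{x_n}] = [1, χ_{x_n}]` converge
both to `[σ, limitChar]` and to `[1, limitChar]`, which differ because σ moves the `y_n`. -/

namespace LCMonoid

/-! ### Normal forms -/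

/-- The action of a generator on words that keeps them reduced. -/
def Gen.act : Gen → List Gen → List Gen
  | .a, .b :: .x n :: w => .b :: .x n :: w
  | .a, .b :: .y n :: w => .b :: .y (n + 1) :: w
  | .a, w => .a :: w
  | c, w => c :: w

theorem Gen.act_b (w : List Gen) : Gen.act .b w = .b :: w := rfl

theorem Gen.act_x (n : ℤ) (w : List Gen) : Gen.act (.x n) w = .x n :: w := rfl

theorem Gen.act_y (n : ℤ) (w : List Gen) : Gen.act (.y n) w = .y n :: w := rfl

theorem Gen.act_a_cases (w : List Gen) :
    (∃ n w', w = .b :: .x n :: w' ∧ Gen.act .a w = .b :: .x n :: w') ∨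
    (∃ n w', w = .b :: .y n :: w' ∧ Gen.act .a w = .b :: .y (n + 1) :: w') ∨
    Gen.act .a w = .a :: w := by
  unfold Gen.act
  split <;> simp_all

/-- The three outcomes of the action of `a` begin with `b x`, `b y` and `a`, so they cannot collide,
and within each the word is recovered since `n ↦ n + 1` is injective. -/
theorem Gen.act_injective (c : Gen) : Function.Injective c.act := by
  intro w w' h
  cases c with
  | a =>
    rcases Gen.act_a_cases w with ⟨n, v, rfl, e⟩ | ⟨n, v, rfl, e⟩ | e <;>
    rcases Gen.act_a_cases w' with ⟨m, v', rfl, e'⟩ | ⟨m, v', rfl, e'⟩ | e' <;>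
    rw [e, e'] at h <;> simp_all
  | b => exact (List.cons.inj h).2
  | x n => exact (List.cons.inj h).2
  | y n => exact (List.cons.inj h).2

namespace ExampleMonoid

/-- The class of a generator. -/
def gen (c : Gen) : ExampleMonoid := PresentedMonoid.of GenRel c

theorem gen_a_b_x (n : ℤ) (w : ExampleMonoid) :
    gen .a * (gen .b * (gen (.x n) * w)) = gen .b * (gen (.x n) * w) := by
  have h : gen .a * gen .b * gen (.x n) = gen .b * gen (.x n) :=
    PresentedMonoid.mk_eq_mk_of_rel (GenRel.x n)
  rw [← mul_assoc, ← mul_assoc, h, mul_assoc]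

theorem gen_a_b_y (n : ℤ) (w : ExampleMonoid) :
    gen .a * (gen .b * (gen (.y n) * w)) = gen .b * (gen (.y (n + 1)) * w) := by
  have h : gen .a * gen .b * gen (.y n) = gen .b * gen (.y (n + 1)) :=
    PresentedMonoid.mk_eq_mk_of_rel (GenRel.y n)
  rw [← mul_assoc, ← mul_assoc, h, mul_assoc]

/-- The action of the monoid on words. -/
def wordAct : ExampleMonoid →* Function.End (List Gen) :=
  PresentedMonoid.lift (M := Function.End (List Gen)) (fun c => Gen.act c) (by
    -- Both sides of a relation act identically on every word, reduced or not.
    rintro _ _ (n | n) <;> rfl)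

/-- The normal form of an element. -/
def nf (s : ExampleMonoid) : List Gen := wordAct s []

/-- The element represented by a word. -/
def ofWord (w : List Gen) : ExampleMonoid := (w.map gen).prod

theorem gen_induction {P : ExampleMonoid → Prop} (one : P 1)
    (gen_mul : ∀ c s, P s → P (gen c * s)) (s : ExampleMonoid) : P s := by
  induction s using PresentedMonoid.inductionOn with
  | h w =>
    induction w using FreeMonoid.inductionOn' with
    | one => exact one
    | of_mul c w ih => exact gen_mul c _ ih

theorem eq_one_or_gen_mul (s : ExampleMonoid) : s = 1 ∨ ∃ c t, s = gen c * t := by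
  induction s using gen_induction with
  | one => exact Or.inl rfl
  | gen_mul c s _ => exact Or.inr ⟨c, s, rfl⟩

theorem nf_gen_mul (c : Gen) (s : ExampleMonoid) : nf (gen c * s) = c.act (nf s) := by
  unfold nf
  rw [map_mul]
  rfl

theorem ofWord_cons (c : Gen) (w : List Gen) : ofWord (c :: w) = gen c * ofWord w := by
  simp [ofWord]

theorem ofWord_act (c : Gen) (w : List Gen) : ofWord (c.act w) = gen c * ofWord w := by
  cases c with
  | a =>
    rcases Gen.act_a_cases w with ⟨n, v, rfl, e⟩ | ⟨n, v, rfl, e⟩ | e <;> rw [e]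
    · simp only [ofWord_cons, gen_a_b_x]
    · simp only [ofWord_cons, gen_a_b_y]
    · exact ofWord_cons _ _
  | b => exact ofWord_cons _ _
  | x n => exact ofWord_cons _ _
  | y n => exact ofWord_cons _ _

/-- Each rewriting done by the action is an instance of a defining relation, so the normal form
still represents the element. Equality in the monoid can thus be tested on words. -/
theorem ofWord_nf (s : ExampleMonoid) : ofWord (nf s) = s := by
  induction s using gen_induction with
  | one => rfl
  | gen_mul c s ih => rw [nf_gen_mul, ofWord_act, ih]

theorem nf_injective : Function.Injective nf :=
  Function.LeftInverse.injective ofWord_nf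

theorem gen_mul_left_cancel {c : Gen} {s t : ExampleMonoid} (h : gen c * s = gen c * t) :
    s = t := by
  have h1 := congrArg nf h
  rw [nf_gen_mul, nf_gen_mul] at h1
  exact nf_injective (c.act_injective h1)

instance isLeftCancelMul : IsLeftCancelMul ExampleMonoid where
  mul_left_cancel s := by
    induction s using gen_induction with
    | one => intro t u h; simpa using h
    | gen_mul c s ih =>
      intro t u h
      simp only [mul_assoc] at h
      exact ih (gen_mul_left_cancel h)

/-- Either a rule applies and `b` comes first, or `a` stays. This separates `aS` from `x_n S` and
`y_n S`, but not from `bS`. -/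
theorem nf_a_mul_head (s : ExampleMonoid) :
    (nf (gen .a * s)).head? = some .a ∨ (nf (gen .a * s)).head? = some .b := by
  rw [nf_gen_mul]
  rcases Gen.act_a_cases (nf s) with ⟨n, v, _, e⟩ | ⟨n, v, _, e⟩ | e <;> simp [e]

theorem gen_mul_ne_one (c : Gen) (s : ExampleMonoid) : gen c * s ≠ 1 := by
  intro h
  have h1 := congrArg nf h
  have h2 : nf 1 = [] := rfl
  cases c with
  | a => have := nf_a_mul_head s; rw [h1, h2] at this; simp at this
  | b => rw [nf_gen_mul, h2] at h1; cases h1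
  | x n => rw [nf_gen_mul, h2] at h1; cases h1
  | y n => rw [nf_gen_mul, h2] at h1; cases h1

/-- No rule has `x_n` as first letter on either side, so a leading `x_n` survives in the normal
form. The same holds for `y_n`. -/
theorem gen_x_mul_eq {n : ℤ} {c : Gen} {s t : ExampleMonoid} (h : gen (.x n) * s = gen c * t) :
    c = .x n ∧ s = t := by
  have h1 := congrArg nf h
  rw [nf_gen_mul, Gen.act_x] at h1
  have hc : c = .x n := by
    cases c with
    | a => have := nf_a_mul_head t; rw [← h1] at this; simp at this
    | b => rw [nf_gen_mul] at h1; cases h1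
    | x m => rw [nf_gen_mul] at h1; exact (List.cons.inj h1).1.symm
    | y m => rw [nf_gen_mul] at h1; cases h1
  subst hc
  exact ⟨rfl, gen_mul_left_cancel h⟩

theorem gen_y_mul_eq {n : ℤ} {c : Gen} {s t : ExampleMonoid} (h : gen (.y n) * s = gen c * t) :
    c = .y n ∧ s = t := by
  have h1 := congrArg nf h
  rw [nf_gen_mul, Gen.act_y] at h1
  have hc : c = .y n := by
    cases c with
    | a => have := nf_a_mul_head t; rw [← h1] at this; simp at this
    | b => rw [nf_gen_mul] at h1; cases h1
    | x m => rw [nf_gen_mul] at h1; cases h1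
    | y m => rw [nf_gen_mul] at h1; exact (List.cons.inj h1).1.symm
  subst hc
  exact ⟨rfl, gen_mul_left_cancel h⟩

/-! ### The shift -/

/-- The graph of the partial bijection `x_n z ↦ x_n z`, `y_n z ↦ y_{n+k} z`. -/
def Shift (k : ℤ) (u v : ExampleMonoid) : Prop :=
  (∃ n z, u = gen (.x n) * z ∧ v = gen (.x n) * z) ∨
    (∃ n z, u = gen (.y n) * z ∧ v = gen (.y (n + k)) * z)

theorem shift_x (k n : ℤ) (z : ExampleMonoid) :
    Shift k (gen (.x n) * z) (gen (.x n) * z) := Or.inl ⟨n, z, rfl, rfl⟩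

theorem shift_y (k n : ℤ) (z : ExampleMonoid) :
    Shift k (gen (.y n) * z) (gen (.y (n + k)) * z) := Or.inr ⟨n, z, rfl, rfl⟩

theorem shift_x_left {k n : ℤ} {z v : ExampleMonoid} :
    Shift k (gen (.x n) * z) v ↔ v = gen (.x n) * z := by
  constructor
  · rintro (⟨m, w, h, rfl⟩ | ⟨m, w, h, rfl⟩)
    · exact h.symm
    · cases (gen_x_mul_eq h).1
  · rintro rfl; exact shift_x _ _ _

theorem shift_y_left {k n : ℤ} {z v : ExampleMonoid} :
    Shift k (gen (.y n) * z) v ↔ v = gen (.y (n + k)) * z := by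
  constructor
  · rintro (⟨m, w, h, rfl⟩ | ⟨m, w, h, rfl⟩)
    · cases (gen_y_mul_eq h).1
    · obtain ⟨h1, rfl⟩ := gen_y_mul_eq h; cases h1; rfl
  · rintro rfl; exact shift_y _ _ _

theorem not_shift_a_left {k : ℤ} {z v : ExampleMonoid} : ¬ Shift k (gen .a * z) v := by
  rintro (⟨m, w, h, -⟩ | ⟨m, w, h, -⟩)
  · cases (gen_x_mul_eq h.symm).1
  · cases (gen_y_mul_eq h.symm).1

theorem not_shift_b_left {k : ℤ} {z v : ExampleMonoid} : ¬ Shift k (gen .b * z) v := by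
  rintro (⟨m, w, h, -⟩ | ⟨m, w, h, -⟩)
  · cases (gen_x_mul_eq h.symm).1
  · cases (gen_y_mul_eq h.symm).1

theorem Shift.symm {k : ℤ} {u v : ExampleMonoid} (h : Shift k u v) : Shift (-k) v u := by
  rcases h with ⟨m, w, rfl, rfl⟩ | ⟨m, w, rfl, rfl⟩
  · exact shift_x _ _ _
  · exact shift_y_left.2 (by rw [add_neg_cancel_right])

theorem shift_neg {k : ℤ} {u v : ExampleMonoid} : Shift (-k) u v ↔ Shift k v u :=
  ⟨fun h => by simpa using h.symm, Shift.symm⟩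

theorem shift_comp {k l : ℤ} {u w : ExampleMonoid} :
    (∃ v, Shift k u v ∧ Shift l v w) ↔ Shift (k + l) u w := by
  constructor
  · rintro ⟨v, ⟨m, z, rfl, rfl⟩ | ⟨m, z, rfl, rfl⟩, h⟩
    · rw [shift_x_left.1 h]; exact shift_x _ _ _
    · rw [shift_y_left.1 h, add_assoc]; exact shift_y _ _ _
  · rintro (⟨m, z, rfl, rfl⟩ | ⟨m, z, rfl, rfl⟩)
    · exact ⟨_, shift_x _ _ _, shift_x _ _ _⟩
    · exact ⟨_, shift_y _ _ _, shift_y_left.2 (by rw [add_assoc])⟩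

/-- The normal form of `a v` starts with `b` only if a rule was applied, so `v` starts with `b x_n`
or `b y_n`. This identifies `aS ∩ bS` with `b · xyIdeal` and `b⁻¹ a b` with the shift by one. -/
theorem gen_a_mul_eq_gen_b_mul {u v : ExampleMonoid} :
    gen .a * v = gen .b * u ↔ ∃ z, v = gen .b * z ∧ Shift 1 z u := by
  constructor
  · intro h
    have h1 := congrArg nf h
    rw [nf_gen_mul, nf_gen_mul, Gen.act_b] at h1
    rcases Gen.act_a_cases (nf v) with ⟨n, w, hv, e⟩ | ⟨n, w, hv, e⟩ | e <;> rw [e] at h1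
    · have h2 := congrArg ofWord (List.cons.inj h1).2
      have h3 := congrArg ofWord hv
      simp only [ofWord_nf, ofWord_cons] at h2 h3
      exact ⟨_, h3, h2 ▸ shift_x _ _ _⟩
    · have h2 := congrArg ofWord (List.cons.inj h1).2
      have h3 := congrArg ofWord hv
      simp only [ofWord_nf, ofWord_cons] at h2 h3
      exact ⟨_, h3, h2 ▸ shift_y _ _ _⟩
    · cases h1
  · rintro ⟨z, rfl, ⟨m, w, rfl, rfl⟩ | ⟨m, w, rfl, rfl⟩⟩
    · exact gen_a_b_x _ _
    · exact gen_a_b_y _ _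

/-- The ideal `⋃ₙ x_n S ∪ ⋃ₙ y_n S`, the domain of the shifts. -/
def xyIdeal : Set ExampleMonoid := {u | ∃ v, Shift 1 u v}

/-- All shifts have the same domain, whatever the exponent. -/
theorem mem_xyIdeal {k : ℤ} {u : ExampleMonoid} : u ∈ xyIdeal ↔ ∃ v, Shift k u v := by
  constructor
  · rintro ⟨v, ⟨m, w, rfl, rfl⟩ | ⟨m, w, rfl, rfl⟩⟩
    · exact ⟨_, shift_x _ _ _⟩
    · exact ⟨_, shift_y _ _ _⟩
  · rintro ⟨v, ⟨m, w, rfl, rfl⟩ | ⟨m, w, rfl, rfl⟩⟩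
    · exact ⟨_, shift_x _ _ _⟩
    · exact ⟨_, shift_y _ _ _⟩

theorem shift_zero {u v : ExampleMonoid} : Shift 0 u v ↔ u ∈ xyIdeal ∧ u = v := by
  constructor
  · intro h
    refine ⟨mem_xyIdeal.2 ⟨v, h⟩, ?_⟩
    rcases h with ⟨m, w, rfl, rfl⟩ | ⟨m, w, rfl, rfl⟩
    · rfl
    · rw [add_zero]
  · rintro ⟨⟨v, ⟨m, w, rfl, rfl⟩ | ⟨m, w, rfl, rfl⟩⟩, rfl⟩
    · exact shift_x _ _ _
    · exact shift_y_left.2 (by rw [add_zero])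

theorem x_mem_xyIdeal (n : ℤ) : gen (.x n) ∈ xyIdeal :=
  ⟨_, by simpa using shift_x 1 n 1⟩

theorem y_mem_xyIdeal (n : ℤ) : gen (.y n) ∈ xyIdeal :=
  ⟨_, by simpa using shift_y 1 n 1⟩

/-! ### The elements of the left inverse hull -/

/-- The identity, or a shift of the ideal `xyIdeal`. -/
def OptShift : Option ℤ → ExampleMonoid → ExampleMonoid → Prop
  | none, u, v => u = v
  | some k, u, v => Shift k u v

/-- The graph of the partial bijection `t σ s⁻¹`, where `σ` is the identity or a shift. -/
def Translate (t : ExampleMonoid) (o : Option ℤ) (s u v : ExampleMonoid) : Prop :=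
  ∃ d w, u = s * d ∧ OptShift o d w ∧ v = t * w

/-- The relations that are empty or of the form `t σ s⁻¹`. -/
def IsTranslate (R : ExampleMonoid → ExampleMonoid → Prop) : Prop :=
  (∀ u v, ¬ R u v) ∨ ∃ t o s, ∀ u v, R u v ↔ Translate t o s u v

theorem IsTranslate.congr {R R' : ExampleMonoid → ExampleMonoid → Prop} (hR : IsTranslate R)
    (h : ∀ u v, R' u v ↔ R u v) : IsTranslate R' := by
  have : R' = R := funext fun u => funext fun v => propext (h u v)
  exact this ▸ hR

theorem isTranslate_translate (t : ExampleMonoid) (o : Option ℤ) (s : ExampleMonoid) :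
    IsTranslate (Translate t o s) := Or.inr ⟨t, o, s, fun _ _ => Iff.rfl⟩

theorem translate_mul_left {g t s u v : ExampleMonoid} {o : Option ℤ} :
    Translate (g * t) o s u v ↔ ∃ w, Translate t o s u w ∧ v = g * w := by
  constructor
  · rintro ⟨d, w, rfl, h, rfl⟩
    exact ⟨t * w, ⟨d, w, rfl, h, rfl⟩, mul_assoc _ _ _⟩
  · rintro ⟨_, ⟨d, w, rfl, h, rfl⟩, rfl⟩
    exact ⟨d, w, rfl, h, (mul_assoc _ _ _).symm⟩

theorem translate_one_left {s u v : ExampleMonoid} {o : Option ℤ} :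
    Translate 1 o s u v ↔ ∃ d, u = s * d ∧ OptShift o d v := by
  simp [Translate]

theorem translate_mul_right {g s u v : ExampleMonoid} :
    Translate 1 none (s * g) u v ↔ u = s * (g * v) := by
  simp [translate_one_left, OptShift, mul_assoc]

theorem IsTranslate.mul_left {R : ExampleMonoid → ExampleMonoid → Prop} (hR : IsTranslate R)
    (g : ExampleMonoid) : IsTranslate (fun u v => ∃ w, R u w ∧ v = g * w) := by
  rcases hR with h | ⟨t, o, s, h⟩
  · exact Or.inl fun u v ⟨w, hw, _⟩ => h u w hw
  · exact (isTranslate_translate (g * t) o s).congr fun u v => by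
      simp only [h, translate_mul_left]

/-- The first letter of `t` decides the composite of a shift with `t σ s⁻¹`. If `t = 1` the
exponents add; a leading `a` or `b` lies outside the domain and gives the empty map; a leading `x_n`
is unchanged and a leading `y_n` becomes `y_{n+k}`. -/
theorem IsTranslate.shift {R : ExampleMonoid → ExampleMonoid → Prop} (hR : IsTranslate R)
    (k : ℤ) : IsTranslate (fun u v => ∃ w, R u w ∧ Shift k w v) := by
  rcases hR with h | ⟨t, o, s, h⟩
  · exact Or.inl fun u v ⟨w, hw, _⟩ => h u w hw
  simp only [h]
  rcases eq_one_or_gen_mul t with rfl | ⟨c, t, rfl⟩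
  · simp only [translate_one_left]
    cases o with
    | none =>
      refine (isTranslate_translate 1 (some k) s).congr fun u v => ?_
      simp [translate_one_left, OptShift]
    | some l =>
      refine (isTranslate_translate 1 (some (l + k)) s).congr fun u v => ?_
      simp only [translate_one_left, OptShift, ← shift_comp]
      constructor
      · rintro ⟨w, ⟨d, rfl, h⟩, h'⟩; exact ⟨d, rfl, w, h, h'⟩
      · rintro ⟨d, rfl, w, h, h'⟩; exact ⟨w, ⟨d, rfl, h⟩, h'⟩
  simp only [translate_mul_left]
  cases c with
  | a => exact Or.inl fun u v ⟨_, ⟨w, _, e⟩, h⟩ => not_shift_a_left (e ▸ h)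
  | b => exact Or.inl fun u v ⟨_, ⟨w, _, e⟩, h⟩ => not_shift_b_left (e ▸ h)
  | x n =>
    refine (isTranslate_translate (gen (.x n) * t) o s).congr fun u v => ?_
    rw [translate_mul_left]
    constructor
    · rintro ⟨_, ⟨w, h, rfl⟩, h'⟩; exact ⟨w, h, shift_x_left.1 h'⟩
    · rintro ⟨w, h, rfl⟩; exact ⟨_, ⟨w, h, rfl⟩, shift_x _ _ _⟩
  | y n =>
    refine (isTranslate_translate (gen (.y (n + k)) * t) o s).congr fun u v => ?_
    rw [translate_mul_left]
    constructor
    · rintro ⟨_, ⟨w, h, rfl⟩, h'⟩; exact ⟨w, h, shift_y_left.1 h'⟩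
    · rintro ⟨w, h, rfl⟩; exact ⟨_, ⟨w, h, rfl⟩, shift_y _ _ _⟩

/-- The factor `c⁻¹` is moved through `t` letter by letter. Equal letters cancel, distinct letters
give the empty map, except for the pair `a`, `b`, which leaves a shift behind. -/
theorem isTranslate_gen_inv_mul (c : Gen) (t : ExampleMonoid) (o : Option ℤ) (s : ExampleMonoid) :
    IsTranslate (fun u v => Translate t o s u (gen c * v)) := by
  induction t using gen_induction with
  | one =>
    cases o with
    | none =>
      refine (isTranslate_translate 1 none (s * gen c)).congr fun u v => ?_
      rw [translate_mul_right]
      simp [translate_one_left, OptShift]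
    | some k =>
      -- Here `c⁻¹ σ^k` is empty for `c = a, b`; otherwise it is `c'⁻¹`, with `c' = x_n` for `c =
      -- x_n` and `c' = y_{n-k}` for `c = y_n`.
      have key : (∀ d v, ¬ Shift k d (gen c * v)) ∨
          ∃ c', ∀ d v, Shift k d (gen c * v) ↔ d = gen c' * v := by
        simp only [← shift_neg (k := k)]
        cases c with
        | a => exact Or.inl fun d v => not_shift_a_left
        | b => exact Or.inl fun d v => not_shift_b_left
        | x n => exact Or.inr ⟨_, fun d v => shift_x_left⟩
        | y n => exact Or.inr ⟨_, fun d v => shift_y_left⟩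
      simp only [translate_one_left, OptShift]
      rcases key with h | ⟨c', h⟩
      · exact Or.inl fun u v ⟨d, _, hd⟩ => h d v hd
      · refine (isTranslate_translate 1 none (s * gen c')).congr fun u v => ?_
        simp [translate_mul_right, h]
  | gen_mul e t ih =>
    by_cases hce : c = e
    · subst hce
      refine (isTranslate_translate t o s).congr fun u v => ?_
      rw [translate_mul_left]
      constructor
      · rintro ⟨w, h, e⟩; exact gen_mul_left_cancel e ▸ h
      · intro h; exact ⟨v, h, rfl⟩
    simp only [translate_mul_left]
    cases c with
    | x n => exact Or.inl fun u v ⟨w, _, h⟩ => hce (gen_x_mul_eq h).1.symm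
    | y n => exact Or.inl fun u v ⟨w, _, h⟩ => hce (gen_y_mul_eq h).1.symm
    | a =>
      cases e with
      | a => exact absurd rfl hce
      | b =>
        -- The rule used is `a⁻¹ b = b σ⁻¹`.
        refine (((isTranslate_translate t o s).shift (-1)).mul_left (gen .b)).congr
          fun u v => ?_
        simp only [gen_a_mul_eq_gen_b_mul, shift_neg]
        constructor
        · rintro ⟨w, h, z, rfl, hz⟩; exact ⟨z, ⟨w, h, hz⟩, rfl⟩
        · rintro ⟨z, ⟨w, h, hz⟩, rfl⟩; exact ⟨w, h, z, rfl, hz⟩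
      | x n => exact Or.inl fun u v ⟨w, _, h⟩ => hce (gen_x_mul_eq h.symm).1
      | y n => exact Or.inl fun u v ⟨w, _, h⟩ => hce (gen_y_mul_eq h.symm).1
    | b =>
      cases e with
      | b => exact absurd rfl hce
      | a =>
        -- The rule used is `b⁻¹ a = σ b⁻¹`; the induction hypothesis treats `b⁻¹ t`.
        refine (ih.shift 1).congr fun u v => ?_
        constructor
        · rintro ⟨w, h, hw⟩
          obtain ⟨z, rfl, hz⟩ := gen_a_mul_eq_gen_b_mul.1 hw.symm
          exact ⟨z, h, hz⟩
        · rintro ⟨z, h, hz⟩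
          exact ⟨_, h, (gen_a_mul_eq_gen_b_mul.2 ⟨z, rfl, hz⟩).symm⟩
      | x n => exact Or.inl fun u v ⟨w, _, h⟩ => hce (gen_x_mul_eq h.symm).1
      | y n => exact Or.inl fun u v ⟨w, _, h⟩ => hce (gen_y_mul_eq h.symm).1

theorem IsTranslate.inv_mul {R : ExampleMonoid → ExampleMonoid → Prop} (hR : IsTranslate R)
    (g : ExampleMonoid) : IsTranslate (fun u v => R u (g * v)) := by
  induction g using gen_induction generalizing R with
  | one => simpa using hR
  | gen_mul c g ih =>
    have h : IsTranslate (fun u v => R u (gen c * v)) := by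
      rcases hR with h | ⟨t, o, s, h⟩
      · exact Or.inl fun u v => h _ _
      · simp only [h]; exact isTranslate_gen_inv_mul c t o s
    simpa only [mul_assoc] using ih h

/-- Composition with an arbitrary `R`, for `g` and its inverse together, is what lets the induction
pass through products and inverses. Taking `R` to be the identity gives the form of all hull
elements. -/
theorem _root_.LCMonoid.InHull.isTranslate_comp {g : ExampleMonoid ≃. ExampleMonoid}
    (hg : InHull g) : ∀ R : ExampleMonoid → ExampleMonoid → Prop, IsTranslate R →
      IsTranslate (fun u v => ∃ w, R u w ∧ g w = some v) ∧
        IsTranslate (fun u v => ∃ w, R u w ∧ g.symm w = some v) := by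
  induction hg with
  | translation s =>
    intro R hR
    constructor
    · refine (hR.mul_left s).congr fun u v => exists_congr fun w => and_congr_right fun _ => ?_
      rw [eq_comm (a := v)]
      exact Option.some_inj
    · refine (hR.inv_mul s).congr fun u v => ?_
      have h : ∀ w, (leftTranslation s).symm w = some v ↔ s * v = w := fun w => by
        rw [PEquiv.eq_some_iff]; exact Option.some_inj
      simp [h]
  | symm _ ih => exact fun R hR => ⟨(ih R hR).2, (ih R hR).1⟩
  | @trans g h _ _ ihg ihh =>
    intro R hR
    constructor
    · refine (ihg _ (ihh R hR).1).1.congr fun u v => ?_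
      simp only [PEquiv.trans_eq_some]
      constructor
      · rintro ⟨x, hx, b, hb, hu⟩; exact ⟨b, ⟨x, hx, hb⟩, hu⟩
      · rintro ⟨b, ⟨x, hx, hb⟩, hu⟩; exact ⟨x, hx, b, hb, hu⟩
    · refine (ihh _ (ihg R hR).2).2.congr fun u v => ?_
      simp only [PEquiv.symm_trans_rev, PEquiv.trans_eq_some]
      constructor
      · rintro ⟨x, hx, b, hb, hu⟩; exact ⟨b, ⟨x, hx, hb⟩, hu⟩
      · rintro ⟨b, ⟨x, hx, hb⟩, hu⟩; exact ⟨x, hx, b, hb, hu⟩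

theorem isTranslate_hull (g : Hull ExampleMonoid) : IsTranslate (fun u v => g u = some v) := by
  refine (g.2.isTranslate_comp _ (isTranslate_translate 1 none 1)).1.congr fun u v => ?_
  simp [translate_one_left, OptShift]

/-! ### Constructible ideals -/

/-- A constructible ideal is the range of a hull element. The range of `t σ s⁻¹` is `tS` if `σ` is
the identity and `t · xyIdeal` if it is a shift, as shifts map `xyIdeal` onto itself. -/
theorem isConstructible_cases {X : Set ExampleMonoid} (hX : IsConstructible X) :
    X = ∅ ∨ ∃ t, (∀ u, u ∈ X ↔ ∃ w, u = t * w) ∨ (∀ u, u ∈ X ↔ ∃ w ∈ xyIdeal, u = t * w) := by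
  obtain ⟨g, hg⟩ := hX.exists_range
  rcases isTranslate_hull g with h | ⟨t, o, s, h⟩
  · left
    ext u
    simp [hg, h]
  refine Or.inr ⟨t, ?_⟩
  simp only [h] at hg
  cases o with
  | none =>
    left
    intro u
    rw [hg]
    constructor
    · rintro ⟨_, d, w, _, _, e⟩; exact ⟨w, e⟩
    · rintro ⟨w, e⟩; exact ⟨s * w, w, w, rfl, rfl, e⟩
  | some k =>
    right
    intro u
    rw [hg]
    constructor
    · rintro ⟨_, d, w, _, hs, e⟩
      exact ⟨w, mem_xyIdeal.2 ⟨d, Shift.symm hs⟩, e⟩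
    · rintro ⟨w, hw, e⟩
      obtain ⟨d, hd⟩ := (mem_xyIdeal (k := -k)).1 hw
      exact ⟨s * d, d, w, rfl, shift_neg.1 hd, e⟩

/-- It is the ideal `b⁻¹ a S`. -/
theorem isConstructible_xyIdeal : IsConstructible xyIdeal := by
  convert IsConstructible.univ.step (gen .b) (gen .a) using 1
  ext u
  have h : ∀ x, gen .b * u = gen .a * x ↔ ∃ z, x = gen .b * z ∧ Shift (-1) u z := fun x => by
    rw [eq_comm, gen_a_mul_eq_gen_b_mul]; simp only [shift_neg]
  simp only [Set.mem_univ, true_and, Set.mem_ofPred_eq, h, mem_xyIdeal (k := -1)]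
  constructor
  · rintro ⟨z, hz⟩; exact ⟨_, z, rfl, hz⟩
  · rintro ⟨_, z, _, hz⟩; exact ⟨z, hz⟩

theorem isConstructible_gen_ideal (c : Gen) :
    IsConstructible {u : ExampleMonoid | ∃ w, u = gen c * w} := by
  convert IsConstructible.univ.step 1 (gen c) using 1
  simp

/-- A constructible ideal contains `xyIdeal`, or its trace on it lies in one principal ideal. -/
theorem xyIdeal_subset_or {Z : Set ExampleMonoid} (hZ : IsConstructible Z) :
    xyIdeal ⊆ Z ∨ ∃ c, ∀ u ∈ Z, u ∈ xyIdeal → ∃ w, u = gen c * w := by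
  rcases isConstructible_cases hZ with rfl | ⟨t, h | h⟩
  · exact Or.inr ⟨.a, by simp⟩
  all_goals
    -- For `t = 1` the ideal is `S` or `xyIdeal`; otherwise it lies in `cS` for a first letter `c`
    -- of `t`.
    rcases eq_one_or_gen_mul t with rfl | ⟨c, t, rfl⟩
    · left
      intro u hu
      simp only [h, one_mul]
      grind
    · refine Or.inr ⟨c, fun u hu _ => ?_⟩
      simp only [h, mul_assoc] at hu
      grind

/-! ### Hull elements that fix two of the `y_n` -/

theorem eq_one_of_mul_eq {t v w : ExampleMonoid} {n m : ℤ} (hnm : n ≠ m)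
    (hv : gen (.y n) = t * v) (hw : gen (.y m) = t * w) : t = 1 := by
  rcases eq_one_or_gen_mul t with rfl | ⟨c, t, rfl⟩
  · rfl
  rw [mul_assoc] at hv hw
  have h1 := (gen_y_mul_eq ((mul_one _).trans hv)).1
  have h2 := (gen_y_mul_eq ((mul_one _).trans hw)).1
  rw [h1] at h2
  cases h2
  exact absurd rfl hnm

theorem eq_one_of_mul_gen_y {t : ExampleMonoid} {n m : ℤ} (h : gen (.y n) = t * gen (.y m)) :
    t = 1 := by
  rcases eq_one_or_gen_mul t with rfl | ⟨c, t, rfl⟩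
  · rfl
  rw [mul_assoc] at h
  have h2 := (gen_y_mul_eq ((mul_one _).trans h)).2
  rcases eq_one_or_gen_mul t with rfl | ⟨e, t, rfl⟩
  · exact absurd (by simpa using h2.symm) (gen_mul_ne_one (.y m) 1)
  · rw [mul_assoc] at h2
    exact absurd h2.symm (gen_mul_ne_one e _)

/-- In `g = t σ s⁻¹` the element `s` divides both `y_n` and `y_m`, so `s = 1`. Then `y_n = t
y_{n+k}` (with `k = 0` if `σ` is the identity) forces `t = 1` and `k = 0`. One fixed `y_n` is not
enough, because of the identity of `y_n S`, and fixed `x_n` are not enough, because of the shifts.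
-/
theorem hull_fix_xyIdeal {g : Hull ExampleMonoid} {n m : ℤ} (hnm : n ≠ m)
    (hn : g (gen (.y n)) = some (gen (.y n))) (hm : g (gen (.y m)) = some (gen (.y m))) :
    ∀ u ∈ xyIdeal, g u = some u := by
  intro u hu
  rcases isTranslate_hull g with h | ⟨t, o, s, h⟩
  · exact absurd hn (h _ _)
  simp only [h] at hn hm ⊢
  obtain ⟨d, w, hd, hdw, hw⟩ := hn
  obtain ⟨d', w', hd', -, -⟩ := hm
  obtain rfl := eq_one_of_mul_eq hnm hd hd'
  rw [one_mul] at hd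
  subst hd
  cases o with
  | none =>
    obtain rfl : _ = w := hdw
    obtain rfl := eq_one_of_mul_gen_y hw
    exact ⟨u, u, by simp, rfl, by simp⟩
  | some k =>
    have hdw' : w = gen (.y (n + k)) * 1 :=
      shift_y_left.1 (by rw [mul_one]; exact hdw)
    rw [mul_one] at hdw'
    subst hdw'
    obtain rfl := eq_one_of_mul_gen_y hw
    have hk : k = 0 := by
      rw [one_mul] at hw
      have := (gen_y_mul_eq (congrArg (· * (1 : ExampleMonoid)) hw)).1
      simpa using this
    subst hk
    exact ⟨u, u, by simp, shift_zero.2 ⟨hu, rfl⟩, by simp⟩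

end ExampleMonoid

/-! ### Strong C*-regularity and the quotient map, for arbitrary monoids -/

section General

variable {S : Type*} [Monoid S] [IsLeftCancelMul S]

/-- Left translations commute with right multiplication, and this passes to inverses and composites.
Hence an element that fixes `t` fixes `tS`. -/
theorem InHull.map_mul_right {g : S ≃. S} (hg : InHull g) :
    ∀ u v z : S, g u = some v → g (u * z) = some (v * z) := by
  induction hg with
  | translation s =>
    intro u v z h
    have h' : s * u = v := Option.some.inj h
    exact congrArg some (by rw [← h', mul_assoc])
  | symm _ ih =>
    intro u v z h
    rw [PEquiv.eq_some_iff] at h ⊢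
    exact ih v u z h
  | trans _ _ ihg ihh =>
    intro u v z h
    rw [PEquiv.trans_eq_some] at h ⊢
    obtain ⟨w, h1, h2⟩ := h
    exact ⟨w * z, ihh _ _ _ h1, ihg _ _ _ h2⟩

theorem mul_idemOf_eq_iff {g : Hull S} {Y : Set S} (hY : IsConstructible Y) :
    g * (idemOf Y hY).1 = (idemOf Y hY).1 ↔ ∀ s ∈ Y, g s = some s := by
  have h := Hull.mul_idem_eq_iff (g := g) (h := 1) (p := idemOf Y hY)
  rw [one_mul, dom_idemOf] at h
  exact h

/-- Strong C*-regularity implies that the relation defining `𝒢(S)` is trivial on `𝒢_P(S)`. -/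
theorem StronglyCStarRegular.canonicalMap_injective (hS : StronglyCStarRegular S) :
    Function.Injective (canonicalMap S) := by
  rintro ⟨⟨g, χ, hg⟩, h1⟩ ⟨⟨k, ψ, hk⟩, h2⟩ h
  have hsim : PatersonArrow.Sim (arrow g χ hg) (arrow k ψ hk) := Quotient.exact h
  obtain ⟨rfl, Y₀, hY₀, H₀⟩ := PatersonArrow.sim_arrow.1 hsim
  refine Subtype.ext (arrow_eq_iff.2 ⟨rfl, ?_⟩)
  have hχ : χ ∈ closure (Set.range pointChar) := h1
  -- Agreement of `g` and `k` may also mean that both are undefined. Cutting down to the domain of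
  -- `g` makes `g⁻¹ k` defined on `Y`, where it fixes every point.
  obtain ⟨Y, hY, hYg, H⟩ : ∃ Y, χ.IsOneAt Y ∧ Y ⊆ g.dom ∧ ∀ s ∈ Y, g s = k s :=
    ⟨_, hY₀.inter (χ.isOneAt_dom hg),
      fun s hs => Hull.mem_dom_domIdem.1 hs.2, fun s hs => H₀ s hs.1⟩
  obtain ⟨U, hU, hχU, hUY⟩ := hY.isOpen_exists
  obtain ⟨X, hX, F, hF, fF, rfl, -, -⟩ := hY
  obtain ⟨m, f, hf⟩ := fF.fin_param
  obtain ⟨hf', rfl⟩ := hf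
  rw [Set.sUnion_range] at hYg H hUY
  -- Density of the `χ_s` shows that the difference set is nonempty, as strong C*-regularity
  -- requires.
  obtain ⟨_, hs, s, rfl⟩ := mem_closure_iff.1 hχ U hU hχU
  obtain ⟨l, Z, hZ, -, hcov, hfix⟩ := hS 1 m (fun _ => g⁻¹ * k) X f hX
    (fun i => hF _ ⟨i, rfl⟩) ⟨s, hUY s hs⟩ (by
      intro s hs
      obtain ⟨t, ht⟩ := hYg hs
      exact Set.mem_iUnion.2 ⟨0, Hull.mul_eq_some.2
        ⟨t, (H s hs).symm.trans ht, Hull.inv_eq_some.2 ht⟩⟩)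
  by_cases hc : ∃ j, χ (idemOf (Z j) (hZ j)) = true
  · obtain ⟨j, hj⟩ := hc
    refine ⟨_, ?_, hj⟩
    rw [Hull.mul_idem_eq_iff, dom_idemOf]
    intro u hu
    obtain ⟨v, hv, hvu⟩ := Hull.mul_eq_some.1 ((mul_idemOf_eq_iff _).1 (hfix j) u hu)
    rw [hv, Hull.inv_eq_some.1 hvu]
  -- If `χ` vanished on all the covering ideals, some `χ_u` near `χ` would have `u` in the
  -- difference set but in none of them.
  · push Not at hc
    obtain ⟨_, ⟨h3, h4⟩, u, rfl⟩ := mem_closure_iff.1 hχ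
      (U ∩ ⋂ j, {φ | φ (idemOf (Z j) (hZ j)) = false})
      (hU.inter (isOpen_iInter_of_finite fun j => isOpen_eval _ _))
      ⟨hχU, Set.mem_iInter.2 fun j => by simpa using hc j⟩
    obtain ⟨j, hj⟩ := Set.mem_iUnion.1 (hcov (hUY u h3))
    have := pointChar_eq_false.1 (Set.mem_iInter.1 h4 j)
    rw [dom_idemOf] at this
    exact absurd hj this

theorem isHomeomorph_canonicalMap (h : Function.Injective (canonicalMap S)) :
    IsHomeomorph (canonicalMap S) :=
  have hq : Topology.IsQuotientMap (canonicalMap S) := isQuotientMap_quotient_mk'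
  ⟨hq.continuous, fun U hU => hq.isOpen_preimage.1 (by rwa [h.preimage_image]),
    h, hq.surjective⟩

theorem isTopologicalIso_canonicalMap (h : Function.Injective (canonicalMap S)) :
    ArrowGroupoid.IsTopologicalIso (groupoidP S) (groupoid S) (canonicalMap S) where
  isHomeomorph := isHomeomorph_canonicalMap h
  source_eq _ := rfl
  range_eq _ := rfl
  map_mul α β h :=
    ((groupoidP S).quotientMul_mk (simSetoid S) (sim_isCongruence S) α β h).symm

/-- The sections `χ ↦ [g, χ]` are continuous. -/
theorem continuous_arrow (g : Hull S) :
    Continuous (fun χ : {χ : SemiChar S // χ g.domIdem = true} => arrow g χ.1 χ.2) := by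
  refine continuous_generateFrom_iff.2 ?_
  rintro _ ⟨k, U, hU, hUk, rfl⟩
  -- The germs of `g` and `k` at `χ` agree exactly when `χ(p) = 1` for some `p` with `g p = k p`, an
  -- open condition.
  have h : (fun χ : {χ : SemiChar S // χ g.domIdem = true} => arrow g χ.1 χ.2) ⁻¹' basicSet k U =
      Subtype.val ⁻¹' (U ∩ ⋃ p : {p : Idem S // g * p.1 = k * p.1}, {χ | χ p.1 = true}) := by
    ext ⟨χ, hχ⟩
    simp only [Set.mem_preimage, basicSet, Set.mem_inter_iff, Set.mem_iUnion, Set.mem_ofPred_eq]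
    constructor
    · rintro ⟨ψ, hψ, hk, e⟩
      obtain ⟨rfl, p, hp, hpχ⟩ := arrow_eq_iff.1 e
      exact ⟨hψ, ⟨p, hp⟩, hpχ⟩
    · rintro ⟨hψ, ⟨p, hp⟩, hpχ⟩
      exact ⟨χ, hψ, hUk hψ, arrow_eq_iff.2 ⟨rfl, p, hp, hpχ⟩⟩
  rw [h]
  exact (hU.inter (isOpen_iUnion fun p => isOpen_eval _ _)).preimage continuous_subtype_val

end General

/-! ### Strong C*-regularity and failure of finite alignment -/

namespace ExampleMonoid

theorem stronglyCStarRegular : StronglyCStarRegular ExampleMonoid := by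
  intro n m h X X' hX hX' hne hsub
  -- A single ideal suffices, namely `X` itself.
  suffices H : ∃ k, ∀ s ∈ X, h k s = some s by
    obtain ⟨k, hk⟩ := H
    exact ⟨1, fun _ => X, fun _ => hX, fun _ => k,
      fun s hs => Set.mem_iUnion.2 ⟨0, hs.1⟩, fun _ => (mul_idemOf_eq_iff hX).2 hk⟩
  have ideal : ∀ {Z : Set ExampleMonoid}, IsConstructible Z → ∀ u ∈ Z, ∀ z, u * z ∈ Z := by
    intro Z hZ u hu z
    obtain ⟨p, rfl⟩ := hZ.exists_idem
    obtain ⟨v, hv⟩ := hu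
    exact ⟨_, p.1.2.map_mul_right _ _ z hv⟩
  rcases isConstructible_cases hX with rfl | ⟨t, hXt | hXt⟩
  · simp at hne
  -- A right ideal containing `t` contains `tS = X`, so the generator `t` is not removed.
  · have ht : t ∈ X \ ⋃ i, X' i := by
      refine ⟨(hXt t).2 ⟨1, (mul_one t).symm⟩, fun hc => ?_⟩
      obtain ⟨i, hi⟩ := Set.mem_iUnion.1 hc
      obtain ⟨u, hu, hu'⟩ := hne
      obtain ⟨w, rfl⟩ := (hXt u).1 hu
      exact hu' (Set.mem_iUnion.2 ⟨i, ideal (hX' i) t hi w⟩)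
    obtain ⟨k, hk⟩ := Set.mem_iUnion.1 (hsub ht)
    refine ⟨k, fun s hs => ?_⟩
    obtain ⟨w, rfl⟩ := (hXt s).1 hs
    exact (h k).2.map_mul_right _ _ w hk
  · have hc : ∀ i, ∃ c, ∀ u ∈ xyIdeal, t * u ∈ X' i → ∃ w, u = gen c * w := by
      intro i
      -- This is the ideal `t⁻¹ X'_i`. It cannot contain `xyIdeal`, since `X'_i` would then contain
      -- all of `X`.
      have hcon := (hX' i).step t 1
      rcases xyIdeal_subset_or hcon with hD | ⟨c, hc⟩
      · obtain ⟨u, hu, hu'⟩ := hne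
        obtain ⟨w, hw, rfl⟩ := (hXt u).1 hu
        obtain ⟨x, hx, e⟩ := hD hw
        rw [one_mul] at e
        exact absurd (Set.mem_iUnion.2 ⟨i, e ▸ hx⟩) hu'
      · exact ⟨c, fun u hu hu' => hc u ⟨_, hu', (one_mul _).symm⟩ hu⟩
    choose c hc using hc
    -- Only the `t y_j` with `y_j` among the finitely many `c i` can be removed.
    have hfin : (Gen.y ⁻¹' Set.range c).Finite :=
      (Set.finite_range c).preimage (fun _ _ _ _ e => Gen.y.inj e)
    have hfix : ∀ j : ↥(Gen.y ⁻¹' Set.range c)ᶜ,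
        ∃ k, h k (t * gen (.y j)) = some (t * gen (.y j)) := by
      rintro ⟨j, hj⟩
      suffices hm : t * gen (.y j) ∉ ⋃ i, X' i by
        have hmem := hsub ⟨(hXt _).2 ⟨_, y_mem_xyIdeal j, rfl⟩, hm⟩
        obtain ⟨k, hk⟩ := Set.mem_iUnion.1 hmem
        exact ⟨k, hk⟩
      intro hm
      obtain ⟨i, hi⟩ := Set.mem_iUnion.1 hm
      obtain ⟨w, hw⟩ := hc i _ (y_mem_xyIdeal j) hi
      exact hj ⟨i, (gen_y_mul_eq ((mul_one _).trans hw)).1⟩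
    choose k hk using hfix
    have : Infinite ↥(Gen.y ⁻¹' Set.range c)ᶜ := hfin.infinite_compl.to_subtype
    -- Pigeonhole: infinitely many points `t y_j`, finitely many `h_k`.
    obtain ⟨i, j, hij, e⟩ := Finite.exists_ne_map_eq_of_infinite k
    refine ⟨k i, ?_⟩
    -- Conjugation by the translation by `t` moves the two fixed points to `y_i` and `y_j`
    -- themselves.
    let T : Hull ExampleMonoid := ⟨_, InHull.translation t⟩
    have hT : ∀ u v, h (k i) (t * u) = some (t * v) ↔ (T⁻¹ * (h (k i) * T)) u = some v := by
      intro u v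
      rw [Hull.mul_eq_some]
      simp only [Hull.inv_eq_some, Hull.mul_eq_some]
      constructor
      · intro e; exact ⟨_, ⟨_, rfl, e⟩, rfl⟩
      · rintro ⟨_, ⟨_, e1, e2⟩, e3⟩
        cases e1; cases e3; exact e2
    have hk' := hk j
    rw [← e] at hk'
    have key := hull_fix_xyIdeal (fun e => hij (Subtype.ext e)) ((hT _ _).1 (hk i))
      ((hT _ _).1 hk')
    intro s hs
    obtain ⟨w, hw, rfl⟩ := (hXt s).1 hs
    exact (hT _ _).2 (key w hw)

theorem not_finitelyAligned : ¬ FinitelyAligned ExampleMonoid := by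
  intro h
  obtain ⟨F, hF, e⟩ := h (gen .a) (gen .b)
  -- A generator `f` that divides `b x_n` itself lies in `aS ∩ bS = b · xyIdeal`, so it has a letter
  -- after `b`, which must be `x_n`. Distinct `n` thus need distinct generators.
  have h1 : ∀ n : ℤ, ∃ f : F, ∃ w, f.1 = gen .b * (gen (.x n) * w) := by
    intro n
    have hn : gen .b * gen (.x n) ∈ {u | ∃ f ∈ F, ∃ v, u = f * v} := by
      rw [← e]
      exact ⟨⟨gen .b * gen (.x n), by simpa using (gen_a_b_x n 1).symm⟩, _, rfl⟩
    obtain ⟨f, hf, v, hv⟩ := hn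
    have hf' : f ∈ {u | ∃ f ∈ F, ∃ v, u = f * v} := ⟨f, hf, 1, (mul_one f).symm⟩
    rw [← e] at hf'
    obtain ⟨⟨p, hp⟩, q, hq⟩ := hf'
    obtain ⟨z, -, ⟨m, w, rfl, rfl⟩ | ⟨m, w, rfl, rfl⟩⟩ :=
      gen_a_mul_eq_gen_b_mul.1 (hp.symm.trans hq)
    · refine ⟨⟨f, hf⟩, w, ?_⟩
      rw [hq, mul_assoc, mul_assoc] at hv
      have h2 := (gen_x_mul_eq ((mul_one _).trans (gen_mul_left_cancel hv))).1
      rw [← h2]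
      exact hq
    · rw [hq, mul_assoc, mul_assoc] at hv
      cases (gen_x_mul_eq ((mul_one _).trans (gen_mul_left_cancel hv))).1
  choose f w hf using h1
  have := hF.to_subtype
  obtain ⟨n, m, hnm, e'⟩ := Finite.exists_ne_map_eq_of_infinite f
  have h3 := hf n
  rw [e', hf m] at h3
  cases (gen_x_mul_eq (gen_mul_left_cancel h3)).1
  exact hnm rfl

/-! ### Failure of the Hausdorff property -/

open scoped Classical in
/-- The semi-character `χ` with `χ(p_X) = 1` if and only if `X` contains `xyIdeal`. -/
noncomputable def limitChar : SemiChar ExampleMonoid where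
  toFun p := decide (xyIdeal ⊆ p.1.dom)
  map_mul' p q := by
    rw [Bool.eq_iff_iff]
    simp only [decide_eq_true_eq, Bool.and_eq_true]
    exact ⟨fun h => ⟨fun s hs => (Idem.mem_dom_mul.1 (h hs)).1,
      fun s hs => (Idem.mem_dom_mul.1 (h hs)).2⟩,
      fun h s hs => Idem.mem_dom_mul.2 ⟨h.1 hs, h.2 hs⟩⟩
  ne_zero' := ⟨idemOf _ isConstructible_xyIdeal, decide_eq_true (by rw [dom_idemOf])⟩

theorem limitChar_eq_true {p : Idem ExampleMonoid} :
    limitChar p = true ↔ xyIdeal ⊆ p.1.dom := by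
  classical exact decide_eq_true_iff

open Filter Topology in
-- Each coordinate is eventually constant: an ideal containing `xyIdeal` contains every `x_n`, and
-- any other constructible ideal meets `xyIdeal` inside some `cS`, which contains at most one `x_n`.
theorem tendsto_pointChar_x :
    Tendsto (fun n : ℤ => pointChar (gen (.x n))) cofinite (𝓝 limitChar) := by
  have hind : Topology.IsInducing (SemiChar.toFun (S := ExampleMonoid)) := ⟨rfl⟩
  rw [hind.tendsto_nhds_iff, tendsto_pi_nhds]
  intro p
  refine tendsto_nhds_of_eventually_eq ?_
  change ∀ᶠ n : ℤ in cofinite, pointChar (gen (.x n)) p = limitChar p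
  by_cases hD : xyIdeal ⊆ p.1.dom
  · refine Eventually.of_forall fun n => ?_
    rw [limitChar_eq_true.2 hD]
    exact pointChar_eq_true.2 (hD (x_mem_xyIdeal n))
  · obtain ⟨c, hc⟩ := (xyIdeal_subset_or p.isConstructible_dom).resolve_left hD
    have h0 : limitChar p = false := by
      rw [← Bool.not_eq_true, limitChar_eq_true]; exact hD
    have hfin : {n : ℤ | Gen.x n = c}.Finite :=
      Set.Subsingleton.finite fun n hn m hm => Gen.x.inj (hn.trans hm.symm)
    refine hfin.eventually_cofinite_notMem.mono fun n hn => ?_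
    rw [h0]
    refine pointChar_eq_false.2 fun hmem => hn ?_
    obtain ⟨w, hw⟩ := hc _ hmem (x_mem_xyIdeal n)
    exact (gen_x_mul_eq ((mul_one _).trans hw)).1.symm

theorem limitChar_mem_Omega : limitChar ∈ Omega ExampleMonoid :=
  mem_closure_of_tendsto tendsto_pointChar_x (Filter.Eventually.of_forall fun _ => ⟨_, rfl⟩)

/-- The shift `x_n z ↦ x_n z`, `y_n z ↦ y_{n+1} z` as the element `b⁻¹ a b` of the hull. -/
noncomputable def shiftElt : Hull ExampleMonoid :=
  (Hull.mk _ (InHull.translation (gen .b)))⁻¹ *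
    (Hull.mk _ (InHull.translation (gen .a)) * Hull.mk _ (InHull.translation (gen .b)))

theorem shiftElt_eq_some {u v : ExampleMonoid} : shiftElt u = some v ↔ Shift 1 u v := by
  have h : shiftElt u = some v ↔ gen .a * (gen .b * u) = gen .b * v := by
    unfold shiftElt
    rw [Hull.mul_eq_some]
    simp only [Hull.inv_eq_some, Hull.mul_eq_some]
    constructor
    · rintro ⟨_, ⟨_, e1, e2⟩, e3⟩
      cases e1; cases e2; exact (Option.some.inj e3).symm
    · intro e; exact ⟨_, ⟨_, rfl, rfl⟩, congrArg some e.symm⟩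
  rw [h, gen_a_mul_eq_gen_b_mul]
  constructor
  · rintro ⟨z, e, hz⟩; exact gen_mul_left_cancel e ▸ hz
  · intro hz; exact ⟨u, rfl, hz⟩

open Filter Topology in
theorem not_t2Space_GPArrow : ¬ T2Space (GPArrow ExampleMonoid) := by
  intro _
  have hσ : ∀ n : ℤ, pointChar (gen (.x n)) shiftElt.domIdem = true := fun n =>
    pointChar_eq_true.2 (Hull.mem_dom_domIdem.2
      ((x_mem_xyIdeal n).imp fun _ => shiftElt_eq_some.2))
  have hσ' : limitChar shiftElt.domIdem = true := limitChar_eq_true.2 fun u hu =>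
    Hull.mem_dom_domIdem.2 (hu.imp fun _ => shiftElt_eq_some.2)
  have lim : ∀ (g : Hull ExampleMonoid) (hg : ∀ n : ℤ, pointChar (gen (.x n)) g.domIdem = true)
      (hg' : limitChar g.domIdem = true),
      Tendsto (fun n : ℤ => (⟨arrow g _ (hg n), subset_closure ⟨_, rfl⟩⟩ : GPArrow ExampleMonoid))
        cofinite (𝓝 ⟨arrow g limitChar hg', limitChar_mem_Omega⟩) := by
    intro g hg hg'
    rw [tendsto_subtype_rng]
    have h1 : Tendsto (fun n : ℤ =>
        (⟨_, hg n⟩ : {χ : SemiChar ExampleMonoid // χ g.domIdem = true})) cofinite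
        (𝓝 ⟨limitChar, hg'⟩) := tendsto_subtype_rng.2 tendsto_pointChar_x
    exact ((continuous_arrow g).tendsto _).comp h1
  -- The shift is the identity on `x_n S`, an ideal at which `χ_{x_n}` takes the value one.
  have heq : ∀ n : ℤ, (⟨arrow shiftElt _ (hσ n), subset_closure ⟨_, rfl⟩⟩ :
      GPArrow ExampleMonoid) = ⟨arrow 1 (pointChar (gen (.x n))) (one_dom _), subset_closure ⟨_, rfl⟩⟩ := by
    intro n
    refine Subtype.ext (arrow_eq_iff.2 ⟨rfl, idemOf _ (isConstructible_gen_ideal (.x n)), ?_, ?_⟩)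
    · rw [Hull.mul_idem_eq_iff, dom_idemOf]
      rintro _ ⟨w, rfl⟩
      exact shiftElt_eq_some.2 (shift_x _ _ _)
    · rw [pointChar_eq_true, dom_idemOf]
      exact ⟨1, (mul_one _).symm⟩
  have l1 := lim shiftElt hσ hσ'
  simp only [heq] at l1
  have hlim := tendsto_nhds_unique l1 (lim 1 (fun _ => one_dom _) (one_dom _))
  obtain ⟨-, p, hp, hpχ⟩ := arrow_eq_iff.1 (congrArg Subtype.val hlim)
  -- If the two limits were equal, the shift would be the identity on an ideal containing `xyIdeal`,
  -- but it sends `y_0` to `y_1`.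
  rw [limitChar_eq_true] at hpχ
  have h0 := Hull.mul_idem_eq_iff.1 hp _ (hpχ (y_mem_xyIdeal 0))
  have h2 := shiftElt_eq_some.1 h0
  rw [← mul_one (gen (.y 0)), shift_y_left] at h2
  cases (gen_y_mul_eq h2).1

end ExampleMonoid

end LCMonoid

theorem proposition3p1 :
    ∃ _ : IsLeftCancelMul LCMonoid.ExampleMonoid,
      LCMonoid.StronglyCStarRegular LCMonoid.ExampleMonoid ∧
      ¬ LCMonoid.FinitelyAligned LCMonoid.ExampleMonoid ∧
      ArrowGroupoid.IsTopologicalIso (LCMonoid.groupoidP LCMonoid.ExampleMonoid)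
        (LCMonoid.groupoid LCMonoid.ExampleMonoid)
        (LCMonoid.canonicalMap LCMonoid.ExampleMonoid) ∧
      ¬ T2Space (LCMonoid.GPArrow LCMonoid.ExampleMonoid) ∧
      ¬ T2Space (LCMonoid.GArrow LCMonoid.ExampleMonoid) := by
  have hinj := LCMonoid.ExampleMonoid.stronglyCStarRegular.canonicalMap_injective
  refine ⟨LCMonoid.ExampleMonoid.isLeftCancelMul, LCMonoid.ExampleMonoid.stronglyCStarRegular,
    LCMonoid.ExampleMonoid.not_finitelyAligned, LCMonoid.isTopologicalIso_canonicalMap hinj,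
    LCMonoid.ExampleMonoid.not_t2Space_GPArrow, fun _ => ?_⟩
  exact LCMonoid.ExampleMonoid.not_t2Space_GPArrow
    (LCMonoid.isHomeomorph_canonicalMap hinj).isEmbedding.t2Space
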